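/- Let $I\subset\mathbb R$ be a nonempty open interval and let $P:I\to\mathbb R$ be a $C^3$ solution of the generalised Chazy equation with parameter $k=\tfrac23$, $$P'''-2PP''+3P'^2-\frac{4}{36-k^2}\,(6P'-P^2)^2=0 .$$ Put $Q=P^2-6P'$ and $R=PQ-\tfrac32Q'$. Fix an antiderivative $\int P$ of $P$ on $I$, write $e^{s\int P}$ for its exponentials, and let $F$ satisfy $F''=e^{\frac12\int P}$. Let $\eta:I\to\mathbb R$ be a nowhere vanishing $C^2$ solution of $\eta''-\tfrac1{40}Q\eta=0$, put $\xi=\eta'/\eta$, and let $\chi$ be an antiderivative of $\eta^{-2}$ on $I$. On $M=I\times\mathbb R^4$ with coordinates $(x,y,z,p,q)$ let $D$ be the distribution annihilated by $$dy-pF''dx,\qquad dp-qF''dx,\qquad dz-q^2F''^2dx,$$ and put $$X^1=\partial_q,\qquad X^2=\partial_x+e^{\frac12\int P}p\,\partial_y+e^{\frac12\int P}q\,\partial_p+e^{\int P}q^2\,\partial_z,$$ $$\begin{aligned}X^3={}&-\eta^3\chi e^{\frac12\int P}\partial_y-\tfrac12\eta^3\chi(6\xi+P)\partial_p+\eta\,\partial_p\\&+\eta^3\chi\Big(e^{-\frac12\int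 P}\big(12\xi^3+6P\xi^2+(P^2+\tfrac Q{20})\xi+\tfrac1{18}P^3+\tfrac{PQ}{120}+\tfrac R{90}\big)y-\big(12\xi^2+3P\xi+\tfrac16P^2-\tfrac Q{60}\big)p\Big)\partial_z\\&+\eta\Big(\tfrac13\big((6\xi+P)^2+\tfrac Q{20}\big)e^{-\frac12\int P}y-(8\xi+P)p+4e^{\frac12\int P}q\Big)\partial_z,\end{aligned}$$ $$J=\tfrac{\eta}{6}e^{-\frac12\int P}\big((6\xi+P)^2+\tfrac Q{20}\big)y-\tfrac\eta2(8\xi+P)p+\eta e^{\frac12\int P}q,\qquad T=\tfrac1\eta p-\tfrac1{2\eta}(6\xi+P)e^{-\frac12\int P}y,$$ $$\begin{aligned}c_1&=\tfrac18J\chi^2-\tfrac18T\chi-\tfrac3{8\eta^3}e^{-\frac12\int P}y,\\c_2&=6z+6\chi J^2-16TJ-4(6\xi+P)p^2+2(6\xi+P)^2e^{-\frac12\int P}yp-\tfrac13(6\xi+P)^3e^{-\int P}y^2\\&\quad+Pp^2+\tfrac Q{10}e^{-\frac12\int P}yp+\tfrac R{30}e^{-\int P}y^2,\\c_3&=-\tfrac12J\chi+T,\qquad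 c_4=-\tfrac18\chi,\qquad c_5=4J,\end{aligned}$$ $$\begin{aligned}\sigma&=\eta^2\Big(\tfrac29\big(216\xi^3+108P\xi^2+18(P^2+\tfrac Q{20})\xi+P^3+\tfrac{3PQ}{20}+\tfrac R5\big)e^{-\int P}y\\&\qquad-2\big(24\xi^2+6P\xi+\tfrac13(P^2-\tfrac Q{10})\big)e^{-\frac12\int P}p+24\xi q\Big),\\\ell_3&=\eta e^{-\frac12\int P}\Big(\big(6\xi^2+\tfrac32P\xi+\tfrac1{12}(P^2-\tfrac Q{10})\big)\eta^2\chi-4\xi-\tfrac12P\Big)c_3^2+\tfrac{1}{4\eta}e^{-\frac12\int P}c_2+\sigma c_1,\end{aligned}$$ $$S^1=-\sigma X^1-8\eta^2X^2,\qquad S^2=\tfrac1{4\eta}e^{-\frac12\int P}X^1,$$ $$\begin{aligned}S^3={}&\ell_3X^1+\Big(\big(\tfrac16((6\xi+P)^2+\tfrac Q{20})e^{-\frac12\int P}y-\tfrac12(8\xi+P)p+e^{\frac12\int P}q\big)\eta^3\chi^2\\&+\big(\tfrac12(6\xi+P)e^{-\frac12\int P}y-p\big)\eta\chi-\tfrac3\eta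 e^{-\frac12\int P}y\Big)X^2-c_3^2X^3.\end{aligned}$$ On $\mathbb R^5$ with coordinates $(c_1,\dots,c_5)$ let the flat Cartan distribution be the one annihilated by $dc_1-2c_4dc_3-4c_3dc_4$, $dc_2+2c_5dc_3+4c_3dc_5$, $dc_3+c_5dc_4-c_4dc_5$, let $Z^1=\partial_{c_3}+2c_5\partial_{c_2}-2c_4\partial_{c_1}$, $Z^2=\partial_{c_4}+4c_3\partial_{c_1}-2c_5\partial_{c_3}$, $Z^3=\partial_{c_5}+2c_4\partial_{c_3}-4c_3\partial_{c_2}$, and call $Z^2+c_5Z^1$, $Z^3-c_4Z^1$, $-c_1Z^2+c_2Z^3-(c_1c_5+c_2c_4+c_3^2)Z^1$ the flat fields. Then: 1. $D$ is spanned at every point of $M$ by $X^1$ and $X^2$, and $S^1,S^2$ are sections of $D$. 2. $(c_1,\dots,c_5):M\to\mathbb R^5$ is smooth and injective with invertible differential everywhere, and it maps $D$ onto the flat Cartan distribution and $S^1,S^2,S^3$ to the three flat fields, in this order. 3. $S^1,S^2,S^3$ are smooth on $M$ and pairwise bracket-generate the Lie algebra of split $\mathfrak g_2$. That is, put $$S^4=[S^1,S^2],\quad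 S^5=[S^2,S^3],\quad S^6=[S^3,S^1],\quad L^1=[S^1,S^4],\quad L^2=[S^2,S^4],\quad L^3=[S^2,S^5],$$ $$L^4=[S^3,S^5],\quad L^5=[S^3,S^6],\quad L^6=[S^1,S^6],\quad H=[S^2,S^6],\quad h=[S^4,S^3],$$ $h^1=\tfrac14(h-H)$ and $h^2=\tfrac{\sqrt3}{12}(h+H)$. Then the fourteen vector fields $S^1,\dots,S^6,h^1,h^2,L^1,\dots,L^6$ form a basis of the real Lie algebra of vector fields on $M$ generated by $S^1,S^2,S^3$; this Lie algebra is isomorphic to the split real form of $\mathfrak g_2$; $h^1,h^2$ span a Cartan subalgebra of it; and each $V$ among $S^1,\dots,S^6,L^1,\dots,L^6$ satisfies $[h^1,V]=aV$, $[h^2,V]=bV$, where $(a,b)$ is, for $S^1,\dots,S^6$, $$(1,0),\ (-\tfrac12,\tfrac{\sqrt3}2),\ (-\tfrac12,-\tfrac{\sqrt3}2),\ (\tfrac12,\tfrac{\sqrt3}2),\ (-1,0),\ (\tfrac12,-\tfrac{\sqrt3}2),$$ and, for $L^1,\dots,L^6$, $$(\tfrac32,\tfrac{\sqrt3}2),\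 (0,\sqrt3),\ (-\tfrac32,\tfrac{\sqrt3}2),\ (-\tfrac32,-\tfrac{\sqrt3}2),\ (0,-\sqrt3),\ (\tfrac32,-\tfrac{\sqrt3}2).$$ -/

import Mathlib

open scoped ContDiff

namespace GenChazy

/-! ### The Lie algebra of smooth vector fields on an open set -/

section VectorFields

variable {E : Type*} [NormedAddCommGroup E] [NormedSpace ℝ E]

/-- Smooth (`C^∞`) vector fields on the open set `U`.  A field on `U` is represented by its
extension by zero to all of `E`, so that two fields are equal iff they agree on `U`. -/
def smoothVectorFields (U : TopologicalSpace.Opens E) : Submodule ℝ (E → E) where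
  carrier := {V | ContDiffOn ℝ ∞ V U ∧ ∀ m, m ∉ U → V m = 0}
  add_mem' := by
    rintro V W ⟨hV, hV0⟩ ⟨hW, hW0⟩
    exact ⟨hV.add hW, fun m hm => by simp [hV0 m hm, hW0 m hm]⟩
  zero_mem' := ⟨contDiffOn_const, fun _ _ => rfl⟩
  smul_mem' := by
    rintro r V ⟨hV, hV0⟩
    exact ⟨hV.const_smul r, fun m hm => by simp [hV0 m hm]⟩

variable {U : TopologicalSpace.Opens E}

theorem contDiffAt_of_mem (V : smoothVectorFields U) {m : E} (hm : m ∈ U) :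
    ContDiffAt ℝ ∞ (V : E → E) m :=
  V.2.1.contDiffAt (U.isOpen.mem_nhds hm)

theorem differentiableAt_of_mem (V : smoothVectorFields U) {m : E} (hm : m ∈ U) :
    DifferentiableAt ℝ (V : E → E) m :=
  (contDiffAt_of_mem V hm).differentiableAt (by simp)

open Classical in
/-- The usual bracket `[V, W] = DW(V) - DV(W)` on `U`, extended by zero. -/
noncomputable instance instBracket :
    Bracket (smoothVectorFields U) (smoothVectorFields U) where
  bracket V W := ⟨fun m => if m ∈ U then VectorField.lieBracket ℝ (V : E → E) (W : E → E) m else 0,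
    by
      refine ⟨?_, fun m hm => by simp [hm]⟩
      have h : ContDiffOn ℝ ∞ (VectorField.lieBracket ℝ (V : E → E) (W : E → E)) U := by
        intro m hm
        exact (ContDiffAt.lieBracket_vectorField (contDiffAt_of_mem V hm)
          (contDiffAt_of_mem W hm) (by simp)).contDiffWithinAt
      exact h.congr (fun m hm => by
        have hm' : m ∈ U := hm
        simp [hm'])⟩

theorem bracket_apply (V W : smoothVectorFields U) {m : E} (hm : m ∈ U) :
    (⁅V, W⁆ : smoothVectorFields U).1 m =
      VectorField.lieBracket ℝ (V : E → E) (W : E → E) m := by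
  exact if_pos hm

theorem bracket_eventuallyEq (V W : smoothVectorFields U) {m : E} (hm : m ∈ U) :
    (⁅V, W⁆ : smoothVectorFields U).1 =ᶠ[nhds m]
      VectorField.lieBracket ℝ (V : E → E) (W : E → E) := by
  filter_upwards [U.isOpen.mem_nhds hm] with a ha using bracket_apply V W ha

theorem ext_on {V W : smoothVectorFields U} (h : ∀ m ∈ U, V.1 m = W.1 m) : V = W := by
  apply Subtype.ext
  funext m
  by_cases hm : m ∈ U
  · exact h m hm
  · rw [V.2.2 m hm, W.2.2 m hm]

noncomputable instance instLieRing : LieRing (smoothVectorFields U) where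
  add_lie V V' W := by
    apply ext_on
    intro m hm
    change _ = (⁅V, W⁆ : smoothVectorFields U).1 m + (⁅V', W⁆ : smoothVectorFields U).1 m
    rw [bracket_apply _ _ hm, bracket_apply _ _ hm, bracket_apply _ _ hm]
    exact VectorField.lieBracket_add_left (differentiableAt_of_mem V hm)
      (differentiableAt_of_mem V' hm)
  lie_add V W W' := by
    apply ext_on
    intro m hm
    change _ = (⁅V, W⁆ : smoothVectorFields U).1 m + (⁅V, W'⁆ : smoothVectorFields U).1 m
    rw [bracket_apply _ _ hm, bracket_apply _ _ hm, bracket_apply _ _ hm]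
    exact VectorField.lieBracket_add_right (differentiableAt_of_mem W hm)
      (differentiableAt_of_mem W' hm)
  lie_self V := by
    apply ext_on
    intro m hm
    rw [bracket_apply _ _ hm]
    simp
  leibniz_lie V W X := by
    apply ext_on
    intro m hm
    change _ = (⁅⁅V, W⁆, X⁆ : smoothVectorFields U).1 m + (⁅W, ⁅V, X⁆⁆ : smoothVectorFields U).1 m
    rw [bracket_apply _ _ hm, bracket_apply _ _ hm, bracket_apply _ _ hm,
      Filter.EventuallyEq.lieBracket_vectorField_eq Filter.EventuallyEq.rfl
        (bracket_eventuallyEq W X hm),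
      Filter.EventuallyEq.lieBracket_vectorField_eq (bracket_eventuallyEq V W hm)
        Filter.EventuallyEq.rfl,
      Filter.EventuallyEq.lieBracket_vectorField_eq Filter.EventuallyEq.rfl
        (bracket_eventuallyEq V X hm)]
    exact VectorField.leibniz_identity_lieBracket (n := ∞) (by simpa using ENat.LEInfty.out)
      (contDiffAt_of_mem V hm) (contDiffAt_of_mem W hm) (contDiffAt_of_mem X hm)

noncomputable instance instLieAlgebra : LieAlgebra ℝ (smoothVectorFields U) where
  lie_smul r V W := by
    apply ext_on
    intro m hm
    change _ = r • (⁅V, W⁆ : smoothVectorFields U).1 m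
    rw [bracket_apply _ _ hm, bracket_apply _ _ hm]
    exact VectorField.lieBracket_const_smul_right (differentiableAt_of_mem W hm)

end VectorFields

/-! ### Pairwise bracket-generating sets of split `𝔤₂` -/

section Generating

variable {V : Type*} [LieRing V] [LieAlgebra ℝ V]

/-- The twelve brackets, in the order `S¹, …, S⁶, L¹, …, L⁶`, where
`S⁴ = [S¹,S²]`, `S⁵ = [S²,S³]`, `S⁶ = [S³,S¹]`, `L¹ = [S¹,S⁴]`, `L² = [S²,S⁴]`, `L³ = [S²,S⁵]`,
`L⁴ = [S³,S⁵]`, `L⁵ = [S³,S⁶]`, `L⁶ = [S¹,S⁶]`. -/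
def rootVectors (S₁ S₂ S₃ : V) : Fin 12 → V :=
  ![S₁, S₂, S₃, ⁅S₁, S₂⁆, ⁅S₂, S₃⁆, ⁅S₃, S₁⁆,
    ⁅S₁, ⁅S₁, S₂⁆⁆, ⁅S₂, ⁅S₁, S₂⁆⁆, ⁅S₂, ⁅S₂, S₃⁆⁆,
    ⁅S₃, ⁅S₂, S₃⁆⁆, ⁅S₃, ⁅S₃, S₁⁆⁆, ⁅S₁, ⁅S₃, S₁⁆⁆]

/-- `H = [S², S⁶]`. -/
def bigH (S₁ S₂ S₃ : V) : V := ⁅S₂, ⁅S₃, S₁⁆⁆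

/-- `h = [S⁴, S³]`. -/
def smallH (S₁ S₂ S₃ : V) : V := ⁅⁅S₁, S₂⁆, S₃⁆

/-- `h¹ = (h - H)/4` and `h² = √3 (h + H)/12`. -/
noncomputable def cartanVectors (S₁ S₂ S₃ : V) : Fin 2 → V :=
  ![(1 / 4 : ℝ) • (smallH S₁ S₂ S₃ - bigH S₁ S₂ S₃),
    (√3 / 12 : ℝ) • (smallH S₁ S₂ S₃ + bigH S₁ S₂ S₃)]

/-- The positions in the plane of the roots of the twelve vectors `S¹, …, S⁶, L¹, …, L⁶`
in the root diagram of type `G₂` (short roots of length `1`, long roots of length `√3`). -/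
noncomputable def rootDiagram : Fin 12 → Fin 2 → ℝ :=
  ![![1, 0], ![-1 / 2, √3 / 2], ![-1 / 2, -√3 / 2],
    ![1 / 2, √3 / 2], ![-1, 0], ![1 / 2, -√3 / 2],
    ![3 / 2, √3 / 2], ![0, √3], ![-3 / 2, √3 / 2],
    ![-3 / 2, -√3 / 2], ![0, -√3], ![3 / 2, -√3 / 2]]

/-- `{S¹, S², S³}` pairwise bracket-generate the Lie algebra of split `𝔤₂`: the Lie algebra that
they generate has as a basis the fourteen vectors `S¹, …, S⁶, h¹, h², L¹, …, L⁶`, it is isomorphic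
to the split real form of `𝔤₂`, the vectors `h¹, h²` span a Cartan subalgebra, and the root diagram
with respect to it is the one above. -/
structure PairwiseBracketGeneratesSplitG2 (S₁ S₂ S₃ : V) : Prop where
  linearIndependent :
    LinearIndependent ℝ (Sum.elim (rootVectors S₁ S₂ S₃) (cartanVectors S₁ S₂ S₃))
  span_eq :
    Submodule.span ℝ (Set.range (Sum.elim (rootVectors S₁ S₂ S₃) (cartanVectors S₁ S₂ S₃))) =
      (LieSubalgebra.lieSpan ℝ V {S₁, S₂, S₃}).toSubmodule
  splitG2 : Nonempty (LieSubalgebra.lieSpan ℝ V {S₁, S₂, S₃} ≃ₗ⁅ℝ⁆ LieAlgebra.g₂ ℝ)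
  cartan : ∃ 𝔥 : LieSubalgebra ℝ (LieSubalgebra.lieSpan ℝ V {S₁, S₂, S₃}),
    𝔥.IsCartanSubalgebra ∧
      𝔥.toSubmodule.map (LieSubalgebra.lieSpan ℝ V {S₁, S₂, S₃}).toSubmodule.subtype =
        Submodule.span ℝ (Set.range (cartanVectors S₁ S₂ S₃))
  roots : ∀ (i : Fin 12) (j : Fin 2),
    ⁅cartanVectors S₁ S₂ S₃ j, rootVectors S₁ S₂ S₃ i⁆ =
      rootDiagram i j • rootVectors S₁ S₂ S₃ i

end Generating

/-! ### The flat Cartan distribution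

Points of `ℝ⁵` are `c = (c₁, c₂, c₃, c₄, c₅) = (c 0, c 1, c 2, c 3, c 4)`. -/

/-- The differential of the `i`-th coordinate function on `ℝ⁵`. -/
def dCoord (i : Fin 5) : (Fin 5 → ℝ) →ₗ[ℝ] ℝ := LinearMap.proj i

/-- The `i`-th coordinate vector field on `ℝ⁵`. -/
def partialVec (i : Fin 5) : Fin 5 → ℝ := Pi.single i 1

/-- The flat Cartan distribution: the common kernel of
`Θ₁ = dc₁ - 2 c₄ dc₃ - 4 c₃ dc₄`, `Θ₂ = dc₂ + 2 c₅ dc₃ + 4 c₃ dc₅`,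
`Θ₃ = dc₃ + c₅ dc₄ - c₄ dc₅`. -/
def flatCartan (c : Fin 5 → ℝ) : Submodule ℝ (Fin 5 → ℝ) :=
  LinearMap.ker (dCoord 0 - (2 * c 3) • dCoord 2 - (4 * c 2) • dCoord 3) ⊓
  LinearMap.ker (dCoord 1 + (2 * c 4) • dCoord 2 + (4 * c 2) • dCoord 4) ⊓
  LinearMap.ker (dCoord 2 + c 4 • dCoord 3 - c 3 • dCoord 4)

/-- `Z¹ = ∂_{c₃} + 2 c₅ ∂_{c₂} - 2 c₄ ∂_{c₁}`. -/
def flatZ1 (c : Fin 5 → ℝ) : Fin 5 → ℝ :=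
  partialVec 2 + (2 * c 4) • partialVec 1 - (2 * c 3) • partialVec 0

/-- `Z² = ∂_{c₄} + 4 c₃ ∂_{c₁} - 2 c₅ ∂_{c₃}`. -/
def flatZ2 (c : Fin 5 → ℝ) : Fin 5 → ℝ :=
  partialVec 3 + (4 * c 2) • partialVec 0 - (2 * c 4) • partialVec 2

/-- `Z³ = ∂_{c₅} + 2 c₄ ∂_{c₃} - 4 c₃ ∂_{c₂}`. -/
def flatZ3 (c : Fin 5 → ℝ) : Fin 5 → ℝ :=
  partialVec 4 + (2 * c 3) • partialVec 2 - (4 * c 2) • partialVec 1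

/-- The flat field `S¹ = Z² + c₅ Z¹`. -/
def flatS1 (c : Fin 5 → ℝ) : Fin 5 → ℝ := flatZ2 c + c 4 • flatZ1 c

/-- The flat field `S² = Z³ - c₄ Z¹`. -/
def flatS2 (c : Fin 5 → ℝ) : Fin 5 → ℝ := flatZ3 c - c 3 • flatZ1 c

/-- The flat field `S³ = -c₁ Z² + c₂ Z³ - (c₁ c₅ + c₂ c₄ + c₃²) Z¹`. -/
def flatS3 (c : Fin 5 → ℝ) : Fin 5 → ℝ :=
  (-c 0) • flatZ2 c + c 1 • flatZ3 c - (c 0 * c 4 + c 1 * c 3 + c 2 ^ 2) • flatZ1 c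

/-! ### The generalised Chazy equation -/

/-- `P` is a (classical) solution on `I` of the generalised Chazy equation with parameter `k`,
`P''' - 2 P P'' + 3 P'² - 4/(36 - k²) (6 P' - P²)² = 0`. -/
def IsGeneralisedChazySolution (k : ℝ) (P : ℝ → ℝ) (I : Set ℝ) : Prop :=
  ContDiffOn ℝ 3 P I ∧ ∀ x ∈ I,
    deriv (deriv (deriv P)) x - 2 * P x * deriv (deriv P) x + 3 * deriv P x ^ 2
      - 4 / (36 - k ^ 2) * (6 * deriv P x - P x ^ 2) ^ 2 = 0

/-- `Q = P² - 6 P'`, that is, `P' = (P² - Q)/6`. -/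
noncomputable def chazyQ (P : ℝ → ℝ) (x : ℝ) : ℝ := P x ^ 2 - 6 * deriv P x

/-- `R = P Q - (3/2) Q'`, that is, `Q' = (2/3) (P Q - R)`. -/
noncomputable def chazyR (P : ℝ → ℝ) (x : ℝ) : ℝ :=
  P x * chazyQ P x - 3 / 2 * deriv (chazyQ P) x

/-! ### The generalised Chazy distribution and its vector fields

Points of `ℝ⁵` are `m = (x, y, z, p, q) = (m 0, m 1, m 2, m 3, m 4)`.  Below, `A` stands for the
chosen antiderivative `∫ P dx`, so that `exp (A x / 2) = exp (½ ∫ P dx)`; `η` is the Ricci-flat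
scale, `ξ = logDeriv η = η'/η`, and `χ` is the chosen antiderivative `∫ η⁻² dx`. -/

/-- The open set of all `(x, y, z, p, q)` with `x ∈ I`. -/
def domain (I : TopologicalSpace.Opens ℝ) : TopologicalSpace.Opens (Fin 5 → ℝ) :=
  I.comap ⟨fun m => m 0, continuous_apply 0⟩

/-- The common kernel of `dy - p F'' dx`, `dp - q F'' dx`, `dz - q² F''² dx`. -/
noncomputable def chazyDistribution (F : ℝ → ℝ) (m : Fin 5 → ℝ) : Submodule ℝ (Fin 5 → ℝ) :=
  LinearMap.ker (dCoord 1 - (m 3 * deriv (deriv F) (m 0)) • dCoord 0) ⊓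
  LinearMap.ker (dCoord 3 - (m 4 * deriv (deriv F) (m 0)) • dCoord 0) ⊓
  LinearMap.ker (dCoord 2 - (m 4 ^ 2 * deriv (deriv F) (m 0) ^ 2) • dCoord 0)

/-- `X¹ = ∂_q`. -/
def X1 (_m : Fin 5 → ℝ) : Fin 5 → ℝ := partialVec 4

/-- `X² = ∂_x + e^{½∫P} p ∂_y + e^{½∫P} q ∂_p + e^{∫P} q² ∂_z`. -/
noncomputable def X2 (A : ℝ → ℝ) (m : Fin 5 → ℝ) : Fin 5 → ℝ :=
  let x := m 0; let p := m 3; let q := m 4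
  partialVec 0 + (Real.exp (A x / 2) * p) • partialVec 1
    + (Real.exp (A x / 2) * q) • partialVec 3 + (Real.exp (A x) * q ^ 2) • partialVec 2

/-- The field `X³`. -/
noncomputable def X3 (P A η χ : ℝ → ℝ) (m : Fin 5 → ℝ) : Fin 5 → ℝ :=
  let x := m 0; let y := m 1; let p := m 3; let q := m 4
  let P₀ := P x; let Q := chazyQ P x; let R := chazyR P x
  let ξ := logDeriv η x
  η x • partialVec 3 - (η x ^ 3 * χ x * Real.exp (A x / 2)) • partialVec 1
    - (η x ^ 3 * χ x / 2 * (6 * ξ + P₀)) • partialVec 3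
    + (η x ^ 3 * χ x *
        (Real.exp (-(A x / 2)) *
            (12 * ξ ^ 3 + 6 * P₀ * ξ ^ 2 + (P₀ ^ 2 + Q / 20) * ξ + P₀ ^ 3 / 18 + P₀ * Q / 120
              + R / 90) * y
          - (12 * ξ ^ 2 + 3 * P₀ * ξ + P₀ ^ 2 / 6 - Q / 60) * p)) • partialVec 2
    + (η x * (1 / 3 * ((6 * ξ + P₀) ^ 2 + Q / 20) * Real.exp (-(A x / 2)) * y
        - (8 * ξ + P₀) * p + 4 * Real.exp (A x / 2) * q)) • partialVec 2

/-- The function `J`. -/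
noncomputable def J (P A η : ℝ → ℝ) (m : Fin 5 → ℝ) : ℝ :=
  let x := m 0; let y := m 1; let p := m 3; let q := m 4
  let P₀ := P x; let Q := chazyQ P x
  let ξ := logDeriv η x
  η x / 6 * Real.exp (-(A x / 2)) * ((6 * ξ + P₀) ^ 2 + Q / 20) * y
    - η x / 2 * (8 * ξ + P₀) * p + η x * Real.exp (A x / 2) * q

/-- The function `c₁`. -/
noncomputable def c1 (P A η χ : ℝ → ℝ) (m : Fin 5 → ℝ) : ℝ :=
  let x := m 0; let y := m 1; let p := m 3
  let ξ := logDeriv η x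
  1 / 8 * J P A η m * χ x ^ 2
    - 1 / 8 * (1 / η x * p - 1 / (2 * η x) * (6 * ξ + P x) * Real.exp (-(A x / 2)) * y) * χ x
    - 3 / (8 * η x ^ 3) * Real.exp (-(A x / 2)) * y

/-- The function `c₂`. -/
noncomputable def c2 (P A η χ : ℝ → ℝ) (m : Fin 5 → ℝ) : ℝ :=
  let x := m 0; let y := m 1; let z := m 2; let p := m 3
  let P₀ := P x; let Q := chazyQ P x; let R := chazyR P x
  let ξ := logDeriv η x
  6 * z + 6 * χ x * J P A η m ^ 2
    - 16 * (1 / η x * p - 1 / (2 * η x) * (6 * ξ + P₀) * Real.exp (-(A x / 2)) * y) * J P A η m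
    - 4 * (6 * ξ + P₀) * p ^ 2 + 2 * (6 * ξ + P₀) ^ 2 * Real.exp (-(A x / 2)) * y * p
    - 1 / 3 * (6 * ξ + P₀) ^ 3 * Real.exp (-A x) * y ^ 2
    + P₀ * p ^ 2 + Q / 10 * Real.exp (-(A x / 2)) * y * p + R / 30 * Real.exp (-A x) * y ^ 2

/-- The function `c₃`. -/
noncomputable def c3 (P A η χ : ℝ → ℝ) (m : Fin 5 → ℝ) : ℝ :=
  let x := m 0; let y := m 1; let p := m 3
  let ξ := logDeriv η x
  1 / η x * p - 1 / (2 * η x) * (6 * ξ + P x) * Real.exp (-(A x / 2)) * y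
    - 1 / 2 * J P A η m * χ x

/-- The change of coordinates `(x, y, z, p, q) ↦ (c₁, c₂, c₃, c₄, c₅)`, with `c₄ = -χ/8` and
`c₅ = 4 J`. -/
noncomputable def flattening (P A η χ : ℝ → ℝ) (m : Fin 5 → ℝ) : Fin 5 → ℝ :=
  ![c1 P A η χ m, c2 P A η χ m, c3 P A η χ m, -(1 / 8) * χ (m 0), 4 * J P A η m]

/-- The function multiplying `-X¹` in `S¹`; it occurs again in `ℓ₃`. -/
noncomputable def s1Coeff (P A η : ℝ → ℝ) (m : Fin 5 → ℝ) : ℝ :=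
  let x := m 0; let y := m 1; let p := m 3; let q := m 4
  let P₀ := P x; let Q := chazyQ P x; let R := chazyR P x
  let ξ := logDeriv η x
  η x ^ 2 *
    (2 / 9 * (216 * ξ ^ 3 + 108 * P₀ * ξ ^ 2 + 18 * (P₀ ^ 2 + Q / 20) * ξ + P₀ ^ 3
        + 3 * P₀ * Q / 20 + R / 5) * Real.exp (-A x) * y
      - 2 * (24 * ξ ^ 2 + 6 * P₀ * ξ + 1 / 3 * (P₀ ^ 2 - Q / 10)) * Real.exp (-(A x / 2)) * p
      + 24 * ξ * q)

/-- The function `ℓ₃`. -/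
noncomputable def ell3 (P A η χ : ℝ → ℝ) (m : Fin 5 → ℝ) : ℝ :=
  let x := m 0
  let P₀ := P x; let Q := chazyQ P x
  let ξ := logDeriv η x
  η x * Real.exp (-(A x / 2)) *
      ((6 * ξ ^ 2 + 3 / 2 * P₀ * ξ + 1 / 12 * (P₀ ^ 2 - Q / 10)) * η x ^ 2 * χ x
        - 4 * ξ - 1 / 2 * P₀) * c3 P A η χ m ^ 2
    + Real.exp (-(A x / 2)) / (4 * η x) * c2 P A η χ m
    + s1Coeff P A η m * c1 P A η χ m

/-- The field `S¹`. -/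
noncomputable def S1 (P A η : ℝ → ℝ) (m : Fin 5 → ℝ) : Fin 5 → ℝ :=
  -s1Coeff P A η m • X1 m - (8 * η (m 0) ^ 2) • X2 A m

/-- The field `S²`. -/
noncomputable def S2 (A η : ℝ → ℝ) (m : Fin 5 → ℝ) : Fin 5 → ℝ :=
  (Real.exp (-(A (m 0) / 2)) / (4 * η (m 0))) • X1 m

/-- The field `S³`. -/
noncomputable def S3 (P A η χ : ℝ → ℝ) (m : Fin 5 → ℝ) : Fin 5 → ℝ :=
  let x := m 0; let y := m 1; let p := m 3; let q := m 4
  let P₀ := P x; let Q := chazyQ P x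
  let ξ := logDeriv η x
  ell3 P A η χ m • X1 m
    + ((1 / 6 * ((6 * ξ + P₀) ^ 2 + Q / 20) * Real.exp (-(A x / 2)) * y
          - 1 / 2 * (8 * ξ + P₀) * p + Real.exp (A x / 2) * q) * η x ^ 3 * χ x ^ 2
        + (1 / 2 * (6 * ξ + P₀) * Real.exp (-(A x / 2)) * y - p) * η x * χ x
        - 3 / η x * Real.exp (-(A x / 2)) * y) • X2 A m
    - c3 P A η χ m ^ 2 • X3 P A η χ m

end GenChazy

/-! The functions χ, Y, K, T, J (see `coordY`, `coordK`, `coordT`, `J`) bring the distribution to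
Hilbert–Cartan form. Along `-S¹/8` their derivatives are 1, T, 6J², J, 0, while `S²` annihilates all
of them except J, whose derivative is 1/4. With χ as independent variable this is the Monge equation
K' = 6(Y'')², where Y' = T and Y'' = J. The map (c₁, …, c₅) is a fixed polynomial expression in the
five functions (`flattening_eq`), and it carries this model to the flat Cartan distribution.

For these computations the Chazy equation and the linear equation for η are rewritten as a
first-order system for P, Q, R, ∫P, ξ, η, χ (`isChazySystem`), which also yields smoothness by
bootstrapping. The value k = 2/3 enters through R' = PR + Q²/80, which is what makes the derivative
of K along `S¹` come out right.

The map is a change of coordinates because it is triangular: χ determines x, since χ' = η⁻² > 0;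
then Y gives y, T gives p, K gives z and J gives q. The field `S³` is the same combination of `S¹`,
`S²` and `liftZ1` as the third flat field is of the first two and Z¹ (`S3_eq`, `flatS3_eq`), so its
image follows by linearity.

All brackets are then computed in flat space, among derivations of a polynomial ring
(`isG2Triple_poly`), and transported to M, because pullback along a local diffeomorphism is a
homomorphism of Lie algebras (`pullbackPolyField`). What remains is algebra
(`IsG2Triple.splitG2_aux`). The relations contain Serre generators of type G₂, hence give a
homomorphism from 𝔤₂ onto the generated Lie algebra. The Serre algebra is spanned by fourteen
elements, while the fourteen vectors in the statement are independent as eigenvectors of the Cartan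
elements. So the homomorphism is injective, and no prior knowledge of the dimension or simplicity of
𝔤₂ is required. -/

namespace GenChazy

/-! ### Lie algebras with a set of Serre generators of type `G₂` -/

section Serre

/-- The Serre relations of type `G₂`, where `0` is the short and `1` the long simple root. -/
structure IsG2Serre {L : Type*} [LieRing L] (e₀ e₁ f₀ f₁ h₀ h₁ : L) : Prop where
  hh : ⁅h₀, h₁⁆ = 0
  e0f0 : ⁅e₀, f₀⁆ = h₀
  e1f1 : ⁅e₁, f₁⁆ = h₁
  e0f1 : ⁅e₀, f₁⁆ = 0
  e1f0 : ⁅e₁, f₀⁆ = 0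
  h0e0 : ⁅h₀, e₀⁆ = (2 : ℤ) • e₀
  h0e1 : ⁅h₀, e₁⁆ = (-3 : ℤ) • e₁
  h1e0 : ⁅h₁, e₀⁆ = (-1 : ℤ) • e₀
  h1e1 : ⁅h₁, e₁⁆ = (2 : ℤ) • e₁
  h0f0 : ⁅h₀, f₀⁆ = (-2 : ℤ) • f₀
  h0f1 : ⁅h₀, f₁⁆ = (3 : ℤ) • f₁
  h1f0 : ⁅h₁, f₀⁆ = (1 : ℤ) • f₀
  h1f1 : ⁅h₁, f₁⁆ = (-2 : ℤ) • f₁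
  serre_e0 : ⁅e₀, ⁅e₀, ⁅e₀, ⁅e₀, e₁⁆⁆⁆⁆ = 0
  serre_e1 : ⁅e₁, ⁅e₁, e₀⁆⁆ = 0
  serre_f0 : ⁅f₀, ⁅f₀, ⁅f₀, ⁅f₀, f₁⁆⁆⁆⁆ = 0
  serre_f1 : ⁅f₁, ⁅f₁, f₀⁆⁆ = 0

variable {L : Type*} [LieRing L]

theorem lie_lie_of_weights {h a b : L} {m n : ℤ} (ha : ⁅h, a⁆ = m • a) (hb : ⁅h, b⁆ = n • b) :
    ⁅h, ⁅a, b⁆⁆ = (m + n) • ⁅a, b⁆ := by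
  rw [leibniz_lie, ha, hb, zsmul_lie, lie_zsmul, add_smul]

/-- The root vectors generated by the simple root vectors `e₀`, `e₁`. -/
def upperRootVectors (e₀ e₁ : L) : Fin 6 → L :=
  ![e₀, e₁, ⁅e₀, e₁⁆, ⁅e₀, ⁅e₀, e₁⁆⁆, ⁅e₀, ⁅e₀, ⁅e₀, e₁⁆⁆⁆, ⁅e₁, ⁅e₀, ⁅e₀, ⁅e₀, e₁⁆⁆⁆⁆]

variable {e₀ e₁ f₀ f₁ h₀ h₁ : L}

namespace IsG2Serre

/-- The Chevalley involution. -/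
theorem symm (hs : IsG2Serre e₀ e₁ f₀ f₁ h₀ h₁) : IsG2Serre f₀ f₁ e₀ e₁ (-h₀) (-h₁) where
  hh := by simp [hs.hh]
  e0f0 := by rw [← lie_skew, hs.e0f0]
  e1f1 := by rw [← lie_skew, hs.e1f1]
  e0f1 := by rw [← lie_skew, hs.e1f0, neg_zero]
  e1f0 := by rw [← lie_skew, hs.e0f1, neg_zero]
  h0e0 := by simp [hs.h0f0]
  h0e1 := by simp [hs.h0f1]
  h1e0 := by simp [hs.h1f0]
  h1e1 := by simp [hs.h1f1]
  h0f0 := by simp [hs.h0e0]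
  h0f1 := by simp [hs.h0e1]
  h1f0 := by simp [hs.h1e0]
  h1f1 := by simp [hs.h1e1]
  serre_e0 := hs.serre_f0
  serre_e1 := hs.serre_f1
  serre_f0 := hs.serre_e0
  serre_f1 := hs.serre_e1

/-- With α short and β long, the six vectors belong to the positive roots α, β, α+β, 2α+β, 3α+β,
3α+2β. Each bracket with a simple generator lands on a multiple of a neighbour, in the Cartan part,
or at zero when the sum of roots is not a root. -/
theorem lie_upper_mem [LieAlgebra ℝ L] (hs : IsG2Serre e₀ e₁ f₀ f₁ h₀ h₁) {W : Submodule ℝ L}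
    (hx : ∀ i, upperRootVectors e₀ e₁ i ∈ W) (hh₀ : h₀ ∈ W) (hh₁ : h₁ ∈ W) (i : Fin 6) :
    ⁅e₀, upperRootVectors e₀ e₁ i⁆ ∈ W ∧ ⁅e₁, upperRootVectors e₀ e₁ i⁆ ∈ W ∧
      ⁅f₀, upperRootVectors e₀ e₁ i⁆ ∈ W ∧ ⁅f₁, upperRootVectors e₀ e₁ i⁆ ∈ W := by
  obtain ⟨x₃, hx₃⟩ : ∃ x, x = ⁅e₀, e₁⁆ := ⟨_, rfl⟩
  obtain ⟨x₄, hx₄⟩ : ∃ x, x = ⁅e₀, x₃⁆ := ⟨_, rfl⟩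
  obtain ⟨x₅, hx₅⟩ : ∃ x, x = ⁅e₀, x₄⁆ := ⟨_, rfl⟩
  obtain ⟨x₆, hx₆⟩ : ∃ x, x = ⁅e₁, x₅⁆ := ⟨_, rfl⟩
  have hU : upperRootVectors e₀ e₁ = ![e₀, e₁, x₃, x₄, x₅, x₆] := by
    simp only [upperRootVectors, ← hx₃, ← hx₄, ← hx₅, ← hx₆]
  rw [hU] at hx ⊢
  have m1 : e₀ ∈ W := hx 0
  have m2 : e₁ ∈ W := hx 1
  have m3 : x₃ ∈ W := hx 2
  have m4 : x₄ ∈ W := hx 3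
  have m5 : x₅ ∈ W := hx 4
  have m6 : x₆ ∈ W := hx 5
  have e10 : ⁅e₁, e₀⁆ = -x₃ := by rw [hx₃, lie_skew]
  have e05 : ⁅e₀, x₅⁆ = 0 := by rw [hx₅, hx₄, hx₃, hs.serre_e0]
  have e13 : ⁅e₁, x₃⁆ = 0 := by
    have := hs.serre_e1
    rwa [e10, lie_neg, neg_eq_zero] at this
  have e14 : ⁅e₁, x₄⁆ = 0 := by
    rw [hx₄, leibniz_lie, e10, e13]; simp
  have x34 : ⁅x₃, x₄⁆ = -x₆ := by
    rw [hx₆, hx₅, leibniz_lie e₁, e10, e14]; simp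
  -- The vanishing at 4α+2β is not among the Serre relations. Expanding `x₆` as `⁅e₁, x₅⁆` and as
  -- `-⁅x₃, x₄⁆` gives opposite values, so twice the bracket is zero.
  have e06a : ⁅e₀, x₆⁆ = ⁅x₃, x₅⁆ := by
    rw [hx₆, leibniz_lie, e05, ← hx₃]; simp
  have e06b : ⁅e₀, x₆⁆ = -⁅x₃, x₅⁆ := by
    rw [← neg_neg x₆, ← x34, lie_neg, leibniz_lie, ← hx₄, ← hx₅]; simp
  have e06 : ⁅e₀, x₆⁆ = 0 := by
    rw [← e06a] at e06b
    have h2 : (2 : ℝ) • ⁅e₀, x₆⁆ = 0 := by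
      rw [two_smul]
      nth_rw 1 [e06b]
      exact neg_add_cancel _
    simpa using h2
  have e16 : ⁅e₁, x₆⁆ = 0 := by
    rw [← neg_neg x₆, ← x34, lie_neg, leibniz_lie, e13, e14]; simp
  have f01 : ⁅f₀, e₀⁆ = -h₀ := by rw [← lie_skew, hs.e0f0]
  have f02 : ⁅f₀, e₁⁆ = 0 := by rw [← lie_skew, hs.e1f0, neg_zero]
  have f11 : ⁅f₁, e₀⁆ = 0 := by rw [← lie_skew, hs.e0f1, neg_zero]
  have f12 : ⁅f₁, e₁⁆ = -h₁ := by rw [← lie_skew, hs.e1f1]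
  have w03 : ⁅h₀, x₃⁆ = (-1 : ℤ) • x₃ := by
    rw [hx₃, lie_lie_of_weights hs.h0e0 hs.h0e1]; rfl
  have w04 : ⁅h₀, x₄⁆ = (1 : ℤ) • x₄ := by
    rw [hx₄, lie_lie_of_weights hs.h0e0 w03]; rfl
  have w13 : ⁅h₁, x₃⁆ = (1 : ℤ) • x₃ := by
    rw [hx₃, lie_lie_of_weights hs.h1e0 hs.h1e1]; rfl
  have w14 : ⁅h₁, x₄⁆ = (0 : ℤ) • x₄ := by
    rw [hx₄, lie_lie_of_weights hs.h1e0 w13]; rfl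
  have w15 : ⁅h₁, x₅⁆ = (-1 : ℤ) • x₅ := by
    rw [hx₅, lie_lie_of_weights hs.h1e0 w14]; rfl
  -- On the α-string through `e₁`, of lowest weight -3, lowering the k-th vector multiplies by k(4 -
  -- k), whence 3, 4, 3.
  have f03 : ⁅f₀, x₃⁆ = (3 : ℤ) • e₁ := by
    rw [hx₃, leibniz_lie, f01, f02, neg_lie, hs.h0e1]; simp
  have f04 : ⁅f₀, x₄⁆ = (4 : ℤ) • x₃ := by
    rw [hx₄, leibniz_lie, f01, f03, neg_lie, w03, lie_zsmul, ← hx₃]; module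
  have f05 : ⁅f₀, x₅⁆ = (3 : ℤ) • x₄ := by
    rw [hx₅, leibniz_lie, f01, f04, neg_lie, w04, lie_zsmul, ← hx₄]; module
  have f06 : ⁅f₀, x₆⁆ = 0 := by
    rw [hx₆, leibniz_lie, f02, f05, lie_zsmul, e14]; simp
  have f13 : ⁅f₁, x₃⁆ = -e₀ := by
    rw [hx₃, leibniz_lie, f11, f12, lie_neg, lie_skew, hs.h1e0]; simp
  have f14 : ⁅f₁, x₄⁆ = 0 := by
    rw [hx₄, leibniz_lie, f11, f13]; simp
  have f15 : ⁅f₁, x₅⁆ = 0 := by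
    rw [hx₅, leibniz_lie, f11, f14]; simp
  have f16 : ⁅f₁, x₆⁆ = x₅ := by
    rw [hx₆, leibniz_lie, f12, f15, neg_lie, w15]; simp
  have hz (n : ℤ) {x : L} (hx : x ∈ W) : n • x ∈ W := zsmul_mem hx n
  fin_cases i
  · exact ⟨by simp, by simpa [e10], by simpa [f01], by simp [f11]⟩
  · exact ⟨by simpa [← hx₃], by simp, by simp [f02], by simpa [f12]⟩
  · exact ⟨by simpa [← hx₄], by simp [e13], f03 ▸ hz 3 m2, by simpa [f13]⟩
  · exact ⟨by simpa [← hx₅], by simp [e14], f04 ▸ hz 4 m3, by simp [f14]⟩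
  · exact ⟨by simp [e05], by simpa [← hx₆], f05 ▸ hz 3 m4, by simp [f15]⟩
  · exact ⟨by simp [e06], by simp [e16], by simp [f06], by simpa [f16]⟩

end IsG2Serre

/-- The span of the root vectors and of the Cartan elements. -/
def serreSpan [LieAlgebra ℝ L] (e₀ e₁ f₀ f₁ h₀ h₁ : L) : Submodule ℝ L :=
  Submodule.span ℝ (Set.range (upperRootVectors e₀ e₁) ∪ Set.range (upperRootVectors f₀ f₁) ∪
    {h₀, h₁})

/-- The negative root vectors need no separate computation: they are the positive ones for the
generators exchanged by the Chevalley involution `symm`. -/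
theorem IsG2Serre.lie_mem_serreSpan [LieAlgebra ℝ L] (hs : IsG2Serre e₀ e₁ f₀ f₁ h₀ h₁) {w : L}
    (hw : w ∈ serreSpan e₀ e₁ f₀ f₁ h₀ h₁) :
    ⁅e₀, w⁆ ∈ serreSpan e₀ e₁ f₀ f₁ h₀ h₁ ∧ ⁅e₁, w⁆ ∈ serreSpan e₀ e₁ f₀ f₁ h₀ h₁ ∧
      ⁅f₀, w⁆ ∈ serreSpan e₀ e₁ f₀ f₁ h₀ h₁ ∧ ⁅f₁, w⁆ ∈ serreSpan e₀ e₁ f₀ f₁ h₀ h₁ := by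
  set W := serreSpan e₀ e₁ f₀ f₁ h₀ h₁ with hW
  have hx (i) : upperRootVectors e₀ e₁ i ∈ W := Submodule.subset_span (Or.inl (Or.inl ⟨i, rfl⟩))
  have hy (i) : upperRootVectors f₀ f₁ i ∈ W := Submodule.subset_span (Or.inl (Or.inr ⟨i, rfl⟩))
  have hh₀ : h₀ ∈ W := Submodule.subset_span (Or.inr (by simp))
  have hh₁ : h₁ ∈ W := Submodule.subset_span (Or.inr (by simp))
  have me₀ : e₀ ∈ W := hx 0
  have me₁ : e₁ ∈ W := hx 1
  have mf₀ : f₀ ∈ W := hy 0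
  have mf₁ : f₁ ∈ W := hy 1
  have hz (n : ℤ) {x : L} (hx : x ∈ W) : n • x ∈ W := zsmul_mem hx n
  induction hw using Submodule.span_induction with
  | mem w hw =>
    obtain (⟨i, rfl⟩ | ⟨i, rfl⟩) | rfl | rfl := hw
    · exact hs.lie_upper_mem hx hh₀ hh₁ i
    · obtain ⟨h1, h2, h3, h4⟩ := hs.symm.lie_upper_mem hy (neg_mem hh₀) (neg_mem hh₁) i
      exact ⟨h3, h4, h1, h2⟩
    · refine ⟨?_, ?_, ?_, ?_⟩ <;> rw [← lie_skew] <;> apply neg_mem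
      · rw [hs.h0e0]; exact hz _ me₀
      · rw [hs.h0e1]; exact hz _ me₁
      · rw [hs.h0f0]; exact hz _ mf₀
      · rw [hs.h0f1]; exact hz _ mf₁
    · refine ⟨?_, ?_, ?_, ?_⟩ <;> rw [← lie_skew] <;> apply neg_mem
      · rw [hs.h1e0]; exact hz _ me₀
      · rw [hs.h1e1]; exact hz _ me₁
      · rw [hs.h1f0]; exact hz _ mf₀
      · rw [hs.h1f1]; exact hz _ mf₁
  | zero => simp
  | add x y _ _ hx hy =>
    simp only [lie_add]
    exact ⟨add_mem hx.1 hy.1, add_mem hx.2.1 hy.2.1, add_mem hx.2.2.1 hy.2.2.1,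
      add_mem hx.2.2.2 hy.2.2.2⟩
  | smul a x _ hx =>
    simp only [lie_smul]
    exact ⟨W.smul_mem _ hx.1, W.smul_mem _ hx.2.1, W.smul_mem _ hx.2.2.1, W.smul_mem _ hx.2.2.2⟩

/-- The elements mapping a subspace to itself form a Lie subalgebra. -/
def subspaceStabilizer [LieAlgebra ℝ L] (W : Submodule ℝ L) : LieSubalgebra ℝ L where
  carrier := {x | ∀ w ∈ W, ⁅x, w⁆ ∈ W}
  add_mem' hx hy w hw := by rw [add_lie]; exact add_mem (hx w hw) (hy w hw)
  zero_mem' w _ := by simp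
  smul_mem' a x hx w hw := by rw [smul_lie]; exact W.smul_mem _ (hx w hw)
  lie_mem' hx hy w hw := by
    rw [lie_lie]; exact sub_mem (hx _ (hy w hw)) (hy _ (hx w hw))

/-- If the Serre generators generate the whole Lie algebra then the root vectors and the Cartan
elements span it. -/
theorem IsG2Serre.serreSpan_eq_top [LieAlgebra ℝ L] (hs : IsG2Serre e₀ e₁ f₀ f₁ h₀ h₁)
    (hgen : ∀ N : LieSubalgebra ℝ L, e₀ ∈ N → e₁ ∈ N → f₀ ∈ N → f₁ ∈ N → N = ⊤) :
    serreSpan e₀ e₁ f₀ f₁ h₀ h₁ = ⊤ := by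
  -- The stabiliser of the span contains the generators, so it is everything. Hence the span is
  -- itself a subalgebra containing the generators, and `hgen` applies a second time.
  have hstab := hgen (subspaceStabilizer (serreSpan e₀ e₁ f₀ f₁ h₀ h₁))
    (fun w hw => (hs.lie_mem_serreSpan hw).1) (fun w hw => (hs.lie_mem_serreSpan hw).2.1)
    (fun w hw => (hs.lie_mem_serreSpan hw).2.2.1) (fun w hw => (hs.lie_mem_serreSpan hw).2.2.2)
  have hlie (x w : L) (hw : w ∈ serreSpan e₀ e₁ f₀ f₁ h₀ h₁) :
      ⁅x, w⁆ ∈ serreSpan e₀ e₁ f₀ f₁ h₀ h₁ := by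
    have hx : x ∈ subspaceStabilizer (serreSpan e₀ e₁ f₀ f₁ h₀ h₁) := hstab ▸ LieSubalgebra.mem_top x
    exact hx w hw
  have htop := hgen { serreSpan e₀ e₁ f₀ f₁ h₀ h₁ with lie_mem' := fun {x} {y} _ hy => hlie x y hy }
    (Submodule.subset_span (Or.inl (Or.inl ⟨0, rfl⟩)))
    (Submodule.subset_span (Or.inl (Or.inl ⟨1, rfl⟩)))
    (Submodule.subset_span (Or.inl (Or.inr ⟨0, rfl⟩)))
    (Submodule.subset_span (Or.inl (Or.inr ⟨1, rfl⟩)))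
  exact congrArg LieSubalgebra.toSubmodule htop

end Serre

/-! ### The Serre generators of `LieAlgebra.g₂ ℝ` -/

section SerreAlgebra

open CartanMatrix

/-- The quotient map from the free Lie algebra onto `𝔤₂`. -/
noncomputable def g2Mk : FreeLieAlgebra ℝ (Generators (Fin 2)) →ₗ⁅ℝ⁆ LieAlgebra.g₂ ℝ where
  toLinearMap := (Relations.toIdeal ℝ G₂).toSubmodule.mkQ
  map_lie' := rfl

theorem g2Mk_surjective : Function.Surjective g2Mk := Submodule.mkQ_surjective _

theorem g2Mk_eq_zero {x : FreeLieAlgebra ℝ (Generators (Fin 2))}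
    (hx : x ∈ Relations.toSet ℝ G₂) : g2Mk x = 0 :=
  (Submodule.Quotient.mk_eq_zero _).2 (LieSubmodule.subset_lieSpan hx)

/-- The images in `𝔤₂` of the generators. -/
noncomputable def g2Gen (x : Generators (Fin 2)) : LieAlgebra.g₂ ℝ := g2Mk (FreeLieAlgebra.of ℝ x)

theorem isG2Serre_g2Gen : IsG2Serre (g2Gen (.E 0)) (g2Gen (.E 1)) (g2Gen (.F 0)) (g2Gen (.F 1))
    (g2Gen (.H 0)) (g2Gen (.H 1)) := by
  have hHH (i j : Fin 2) := g2Mk_eq_zero (x := Relations.HH ℝ (i, j)) (by simp [Relations.toSet])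
  have hEF (i j : Fin 2) := g2Mk_eq_zero (x := Relations.EF ℝ (i, j)) (by simp [Relations.toSet])
  have hHE (i j : Fin 2) := g2Mk_eq_zero (x := Relations.HE ℝ G₂ (i, j))
    (by simp [Relations.toSet])
  have hHF (i j : Fin 2) := g2Mk_eq_zero (x := Relations.HF ℝ G₂ (i, j))
    (by simp [Relations.toSet])
  have hE (i j : Fin 2) := g2Mk_eq_zero (x := Relations.adE ℝ G₂ (i, j))
    (by simp [Relations.toSet])
  have hF (i j : Fin 2) := g2Mk_eq_zero (x := Relations.adF ℝ G₂ (i, j))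
    (by simp [Relations.toSet])
  -- The power of ad Eᵢ is applied to `⁅Eᵢ, Eⱼ⁆` rather than to Eⱼ, so exponents 3 and 1 produce
  -- brackets with four and two factors Eᵢ.
  have t3 : (3 : ℤ).toNat = 3 := rfl
  have t1 : (1 : ℤ).toNat = 1 := rfl
  simp only [Relations.HH, Relations.EF, Relations.HE, Relations.HF, Relations.adE, Relations.adF,
    Function.uncurry_apply_pair, Function.comp_apply, map_sub, map_add, LieHom.map_lie, map_zsmul,
    Fin.forall_fin_two, G₂, Matrix.of_apply, Matrix.cons_val_zero, Matrix.cons_val_one,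
    sub_eq_zero, add_eq_zero_iff_eq_neg, ← neg_smul, if_true, zero_ne_one, one_ne_zero, if_false,
    neg_neg, t3, t1, pow_succ, pow_zero, one_mul, Module.End.mul_apply, LieAlgebra.ad_apply]
    at hHH hEF hHE hHF hE hF
  exact ⟨hHH.1.2, hEF.1.1, hEF.2.2, hEF.1.2, hEF.2.1, hHE.1.1, hHE.1.2, hHE.2.1, hHE.2.2,
    hHF.1.1, hHF.1.2, hHF.2.1, hHF.2.2, hE.1.2, hE.2.1, hF.1.2, hF.2.1⟩

/-- The generators lie in `N`, the elements H being brackets of E and F. So the quotient map from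
the free Lie algebra factors through `N`, and it is surjective. -/
theorem g2_subalgebra_eq_top (N : LieSubalgebra ℝ (LieAlgebra.g₂ ℝ)) (h₀ : g2Gen (.E 0) ∈ N)
    (h₁ : g2Gen (.E 1) ∈ N) (h₂ : g2Gen (.F 0) ∈ N) (h₃ : g2Gen (.F 1) ∈ N) : N = ⊤ := by
  have hgen : ∀ x, g2Gen x ∈ N := by
    have hs := isG2Serre_g2Gen
    rintro (i | i | i) <;> fin_cases i
    · exact hs.e0f0 ▸ N.lie_mem h₀ h₂
    · exact hs.e1f1 ▸ N.lie_mem h₁ h₃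
    all_goals assumption
  let φ : FreeLieAlgebra ℝ (Generators (Fin 2)) →ₗ⁅ℝ⁆ N :=
    FreeLieAlgebra.lift ℝ fun x => ⟨g2Gen x, hgen x⟩
  have hφ : N.incl.comp φ = g2Mk := by
    apply FreeLieAlgebra.hom_ext
    intro x
    simp [φ, FreeLieAlgebra.lift_of_apply, g2Gen]
  rw [eq_top_iff]
  intro x _
  obtain ⟨y, rfl⟩ := g2Mk_surjective x
  rw [← hφ]
  exact (φ y).2

variable {V : Type*} [LieRing V] [LieAlgebra ℝ V]

/-- Serre generators of type `G₂` define a homomorphism from `𝔤₂`. -/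
theorem IsG2Serre.exists_hom {e₀ e₁ f₀ f₁ h₀ h₁ : V} (hs : IsG2Serre e₀ e₁ f₀ f₁ h₀ h₁) :
    ∃ ψ : LieAlgebra.g₂ ℝ →ₗ⁅ℝ⁆ V, ψ (g2Gen (.E 0)) = e₀ ∧ ψ (g2Gen (.E 1)) = e₁ ∧
      ψ (g2Gen (.F 0)) = f₀ ∧ ψ (g2Gen (.F 1)) = f₁ := by
  let g : Generators (Fin 2) → V
    | .H i => ![h₀, h₁] i
    | .E i => ![e₀, e₁] i
    | .F i => ![f₀, f₁] i
  let φ : FreeLieAlgebra ℝ (Generators (Fin 2)) →ₗ⁅ℝ⁆ V := FreeLieAlgebra.lift ℝ g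
  have hφ (x) : φ (FreeLieAlgebra.of ℝ x) = g x := FreeLieAlgebra.lift_of_apply ..
  have h3 : (3 : ℤ).toNat = 3 := rfl
  have h1 : (1 : ℤ).toNat = 1 := rfl
  -- On the diagonal the exponent truncates to 0 and the Serre relation degenerates to `⁅Eᵢ, Eᵢ⁆ =
  -- 0`.
  have h2 : (-2 : ℤ).toNat = 0 := rfl
  have hker : Relations.toIdeal ℝ G₂ ≤ φ.ker := by
    rw [Relations.toIdeal, LieSubmodule.lieSpan_le]
    rintro x (((((⟨⟨i, j⟩, rfl⟩ | ⟨⟨i, j⟩, rfl⟩) | ⟨⟨i, j⟩, rfl⟩) | ⟨⟨i, j⟩, rfl⟩) |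
      ⟨⟨i, j⟩, rfl⟩) | ⟨⟨i, j⟩, rfl⟩)
    · have hh' : ⁅h₁, h₀⁆ = 0 := by rw [← lie_skew, hs.hh, neg_zero]
      fin_cases i <;> fin_cases j <;> simp [Relations.HH, hφ, g, hh', hs.hh]
    · fin_cases i <;> fin_cases j <;>
        simp [Relations.EF, hφ, g, hs.e0f0, hs.e1f1, hs.e0f1, hs.e1f0]
    · fin_cases i <;> fin_cases j <;>
        simp [Relations.HE, hφ, g, G₂, hs.h0e0, hs.h0e1, hs.h1e0, hs.h1e1]
    · fin_cases i <;> fin_cases j <;>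
        simp [Relations.HF, hφ, g, G₂, hs.h0f0, hs.h0f1, hs.h1f0, hs.h1f1]
    · fin_cases i <;> fin_cases j <;>
        simp [Relations.adE, hφ, g, G₂, h1, h2, h3, pow_succ, hs.serre_e0, hs.serre_e1]
    · fin_cases i <;> fin_cases j <;>
        simp [Relations.adF, hφ, g, G₂, h1, h2, h3, pow_succ, hs.serre_f0, hs.serre_f1]
  let ψ : LieAlgebra.g₂ ℝ →ₗ⁅ℝ⁆ V :=
    { toLinearMap := (Relations.toIdeal ℝ G₂).toSubmodule.liftQ φ.toLinearMap
        fun x hx => LieHom.mem_ker.1 (hker hx)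
      map_lie' := by
        intro x y
        obtain ⟨x, rfl⟩ := g2Mk_surjective x
        obtain ⟨y, rfl⟩ := g2Mk_surjective y
        exact φ.map_lie x y }
  exact ⟨ψ, hφ _, hφ _, hφ _, hφ _⟩

end SerreAlgebra

/-! ### A finite list of relations forcing split `𝔤₂` -/

section Triple

/-- Relations among the brackets of `S₁`, `S₂`, `S₃` that determine the Lie algebra generated by
them. -/
structure IsG2Triple {V : Type*} [LieRing V] [LieAlgebra ℝ V]
    (S₁ S₂ S₃ S₄ S₅ S₆ L₁ L₂ L₃ L₄ L₅ L₆ H h : V) : Prop where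
  s1s2 : ⁅S₁, S₂⁆ = S₄
  s2s3 : ⁅S₂, S₃⁆ = S₅
  s3s1 : ⁅S₃, S₁⁆ = S₆
  s1s4 : ⁅S₁, S₄⁆ = L₁
  s2s4 : ⁅S₂, S₄⁆ = L₂
  s2s5 : ⁅S₂, S₅⁆ = L₃
  s3s5 : ⁅S₃, S₅⁆ = L₄
  s3s6 : ⁅S₃, S₆⁆ = L₅
  s1s6 : ⁅S₁, S₆⁆ = L₆
  s2s6 : ⁅S₂, S₆⁆ = H
  s4s3 : ⁅S₄, S₃⁆ = h
  hs1 : ⁅h, S₁⁆ = (2 : ℝ) • S₁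
  hs2 : ⁅h, S₂⁆ = (2 : ℝ) • S₂
  hs3 : ⁅h, S₃⁆ = (-4 : ℝ) • S₃
  Hs1 : ⁅H, S₁⁆ = (-2 : ℝ) • S₁
  Hs2 : ⁅H, S₂⁆ = (4 : ℝ) • S₂
  Hs3 : ⁅H, S₃⁆ = (-2 : ℝ) • S₃
  s1l3 : ⁅S₁, L₃⁆ = (-6 : ℝ) • S₂
  l3l1 : ⁅L₃, L₁⁆ = (6 : ℝ) • L₂
  s5l6 : ⁅S₅, L₆⁆ = (6 : ℝ) • S₆
  s5s6 : ⁅S₅, S₆⁆ = (-8 : ℝ) • S₃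
  l4l6 : ⁅L₄, L₆⁆ = (6 : ℝ) • L₅
  l3l6 : ⁅L₃, L₆⁆ = (12 : ℝ) • H - (6 : ℝ) • h
  s1l6 : ⁅S₁, L₆⁆ = 0
  l3s5 : ⁅L₃, S₅⁆ = 0
  s1l1 : ⁅S₁, L₁⁆ = 0
  s2l3 : ⁅S₂, L₃⁆ = 0
  s5l4 : ⁅S₅, L₄⁆ = 0
  l6s6 : ⁅L₆, S₆⁆ = 0
  s5l1 : ⁅S₅, L₁⁆ = (6 : ℝ) • S₄
  s6l2 : ⁅S₆, L₂⁆ = (6 : ℝ) • S₄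
  s1l4 : ⁅S₁, L₄⁆ = (-6 : ℝ) • S₃
  s2l5 : ⁅S₂, L₅⁆ = (-6 : ℝ) • S₃

/-- The eigenvalues of `ad h` on the root vectors. -/
def weightSmallH : Fin 12 → ℤ := ![2, 2, -4, 4, -2, -2, 6, 6, 0, -6, -6, 0]

/-- The eigenvalues of `ad H` on the root vectors. -/
def weightBigH : Fin 12 → ℤ := ![-2, 4, -2, 2, 2, -4, 0, 6, 6, 0, -6, -6]

variable {V : Type*} [LieRing V] [LieAlgebra ℝ V]

theorem lie_lie_of_real_weights {h a b : V} {m n k : ℝ} (ha : ⁅h, a⁆ = m • a) (hb : ⁅h, b⁆ = n • b)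
    (hk : m + n = k) : ⁅h, ⁅a, b⁆⁆ = k • ⁅a, b⁆ := by
  rw [leibniz_lie, ha, hb, smul_lie, lie_smul, ← add_smul, hk]

variable {S₁ S₂ S₃ S₄ S₅ S₆ L₁ L₂ L₃ L₄ L₅ L₆ H h : V}

namespace IsG2Triple

theorem map {V' : Type*} [LieRing V'] [LieAlgebra ℝ V'] (φ : V →ₗ⁅ℝ⁆ V')
    (r : IsG2Triple S₁ S₂ S₃ S₄ S₅ S₆ L₁ L₂ L₃ L₄ L₅ L₆ H h) :
    IsG2Triple (φ S₁) (φ S₂) (φ S₃) (φ S₄) (φ S₅) (φ S₆) (φ L₁) (φ L₂) (φ L₃) (φ L₄) (φ L₅) (φ L₆)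
      (φ H) (φ h) where
  s1s2 := by rw [← φ.map_lie, r.s1s2]
  s2s3 := by rw [← φ.map_lie, r.s2s3]
  s3s1 := by rw [← φ.map_lie, r.s3s1]
  s1s4 := by rw [← φ.map_lie, r.s1s4]
  s2s4 := by rw [← φ.map_lie, r.s2s4]
  s2s5 := by rw [← φ.map_lie, r.s2s5]
  s3s5 := by rw [← φ.map_lie, r.s3s5]
  s3s6 := by rw [← φ.map_lie, r.s3s6]
  s1s6 := by rw [← φ.map_lie, r.s1s6]
  s2s6 := by rw [← φ.map_lie, r.s2s6]
  s4s3 := by rw [← φ.map_lie, r.s4s3]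
  hs1 := by rw [← φ.map_lie, r.hs1, map_smul]
  hs2 := by rw [← φ.map_lie, r.hs2, map_smul]
  hs3 := by rw [← φ.map_lie, r.hs3, map_smul]
  Hs1 := by rw [← φ.map_lie, r.Hs1, map_smul]
  Hs2 := by rw [← φ.map_lie, r.Hs2, map_smul]
  Hs3 := by rw [← φ.map_lie, r.Hs3, map_smul]
  s1l3 := by rw [← φ.map_lie, r.s1l3, map_smul]
  l3l1 := by rw [← φ.map_lie, r.l3l1, map_smul]
  s5l6 := by rw [← φ.map_lie, r.s5l6, map_smul]
  s5s6 := by rw [← φ.map_lie, r.s5s6, map_smul]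
  l4l6 := by rw [← φ.map_lie, r.l4l6, map_smul]
  l3l6 := by rw [← φ.map_lie, r.l3l6, map_sub, map_smul, map_smul]
  s1l6 := by rw [← φ.map_lie, r.s1l6, map_zero]
  l3s5 := by rw [← φ.map_lie, r.l3s5, map_zero]
  s1l1 := by rw [← φ.map_lie, r.s1l1, map_zero]
  s2l3 := by rw [← φ.map_lie, r.s2l3, map_zero]
  s5l4 := by rw [← φ.map_lie, r.s5l4, map_zero]
  l6s6 := by rw [← φ.map_lie, r.l6s6, map_zero]
  s5l1 := by rw [← φ.map_lie, r.s5l1, map_smul]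
  s6l2 := by rw [← φ.map_lie, r.s6l2, map_smul]
  s1l4 := by rw [← φ.map_lie, r.s1l4, map_smul]
  s2l5 := by rw [← φ.map_lie, r.s2l5, map_smul]

theorem rootVectors_eq (r : IsG2Triple S₁ S₂ S₃ S₄ S₅ S₆ L₁ L₂ L₃ L₄ L₅ L₆ H h) :
    rootVectors S₁ S₂ S₃ = ![S₁, S₂, S₃, S₄, S₅, S₆, L₁, L₂, L₃, L₄, L₅, L₆] := by
  simp only [rootVectors, r.s1s2, r.s2s3, r.s3s1, r.s1s4, r.s2s4, r.s2s5, r.s3s5, r.s3s6, r.s1s6]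

theorem cartanVectors_eq (r : IsG2Triple S₁ S₂ S₃ S₄ S₅ S₆ L₁ L₂ L₃ L₄ L₅ L₆ H h) :
    cartanVectors S₁ S₂ S₃ = ![(1 / 4 : ℝ) • (h - H), (√3 / 12 : ℝ) • (h + H)] := by
  simp only [cartanVectors, smallH, bigH, r.s1s2, r.s3s1, r.s2s6, r.s4s3]

theorem smallH_lie (r : IsG2Triple S₁ S₂ S₃ S₄ S₅ S₆ L₁ L₂ L₃ L₄ L₅ L₆ H h) (i : Fin 12) :
    ⁅h, rootVectors S₁ S₂ S₃ i⁆ = (weightSmallH i : ℝ) • rootVectors S₁ S₂ S₃ i := by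
  have w4 : ⁅h, S₄⁆ = (4 : ℝ) • S₄ :=
    r.s1s2 ▸ lie_lie_of_real_weights r.hs1 r.hs2 (by norm_num)
  have w5 : ⁅h, S₅⁆ = (-2 : ℝ) • S₅ :=
    r.s2s3 ▸ lie_lie_of_real_weights r.hs2 r.hs3 (by norm_num)
  have w6 : ⁅h, S₆⁆ = (-2 : ℝ) • S₆ :=
    r.s3s1 ▸ lie_lie_of_real_weights r.hs3 r.hs1 (by norm_num)
  rw [r.rootVectors_eq]
  fin_cases i
  · simpa [weightSmallH] using r.hs1
  · simpa [weightSmallH] using r.hs2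
  · simpa [weightSmallH] using r.hs3
  · simpa [weightSmallH] using w4
  · simpa [weightSmallH] using w5
  · simpa [weightSmallH] using w6
  · simpa [weightSmallH, r.s1s4] using lie_lie_of_real_weights (k := 6) r.hs1 w4 (by norm_num)
  · simpa [weightSmallH, r.s2s4] using lie_lie_of_real_weights (k := 6) r.hs2 w4 (by norm_num)
  · simpa [weightSmallH, r.s2s5] using lie_lie_of_real_weights (k := 0) r.hs2 w5 (by norm_num)
  · simpa [weightSmallH, r.s3s5] using lie_lie_of_real_weights (k := -6) r.hs3 w5 (by norm_num)
  · simpa [weightSmallH, r.s3s6] using lie_lie_of_real_weights (k := -6) r.hs3 w6 (by norm_num)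
  · simpa [weightSmallH, r.s1s6] using lie_lie_of_real_weights (k := 0) r.hs1 w6 (by norm_num)

theorem bigH_lie (r : IsG2Triple S₁ S₂ S₃ S₄ S₅ S₆ L₁ L₂ L₃ L₄ L₅ L₆ H h) (i : Fin 12) :
    ⁅H, rootVectors S₁ S₂ S₃ i⁆ = (weightBigH i : ℝ) • rootVectors S₁ S₂ S₃ i := by
  have w4 : ⁅H, S₄⁆ = (2 : ℝ) • S₄ :=
    r.s1s2 ▸ lie_lie_of_real_weights r.Hs1 r.Hs2 (by norm_num)
  have w5 : ⁅H, S₅⁆ = (2 : ℝ) • S₅ :=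
    r.s2s3 ▸ lie_lie_of_real_weights r.Hs2 r.Hs3 (by norm_num)
  have w6 : ⁅H, S₆⁆ = (-4 : ℝ) • S₆ :=
    r.s3s1 ▸ lie_lie_of_real_weights r.Hs3 r.Hs1 (by norm_num)
  rw [r.rootVectors_eq]
  fin_cases i
  · simpa [weightBigH] using r.Hs1
  · simpa [weightBigH] using r.Hs2
  · simpa [weightBigH] using r.Hs3
  · simpa [weightBigH] using w4
  · simpa [weightBigH] using w5
  · simpa [weightBigH] using w6
  · simpa [weightBigH, r.s1s4] using lie_lie_of_real_weights (k := 0) r.Hs1 w4 (by norm_num)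
  · simpa [weightBigH, r.s2s4] using lie_lie_of_real_weights (k := 6) r.Hs2 w4 (by norm_num)
  · simpa [weightBigH, r.s2s5] using lie_lie_of_real_weights (k := 6) r.Hs2 w5 (by norm_num)
  · simpa [weightBigH, r.s3s5] using lie_lie_of_real_weights (k := 0) r.Hs3 w5 (by norm_num)
  · simpa [weightBigH, r.s3s6] using lie_lie_of_real_weights (k := -6) r.Hs3 w6 (by norm_num)
  · simpa [weightBigH, r.s1s6] using lie_lie_of_real_weights (k := -6) r.Hs1 w6 (by norm_num)

theorem bigH_smallH (r : IsG2Triple S₁ S₂ S₃ S₄ S₅ S₆ L₁ L₂ L₃ L₄ L₅ L₆ H h) : ⁅H, h⁆ = 0 := by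
  have w4 : ⁅H, S₄⁆ = (2 : ℝ) • S₄ :=
    r.s1s2 ▸ lie_lie_of_real_weights r.Hs1 r.Hs2 (by norm_num)
  rw [← r.s4s3, lie_lie_of_real_weights (k := 0) w4 r.Hs3 (by norm_num), zero_smul]

theorem cartanVectors_lie (r : IsG2Triple S₁ S₂ S₃ S₄ S₅ S₆ L₁ L₂ L₃ L₄ L₅ L₆ H h)
    (i : Fin 12) (j : Fin 2) :
    ⁅cartanVectors S₁ S₂ S₃ j, rootVectors S₁ S₂ S₃ i⁆ =
      rootDiagram i j • rootVectors S₁ S₂ S₃ i := by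
  have hd : rootDiagram i j = ![(1 / 4 : ℝ) * (weightSmallH i - weightBigH i),
      (√3 / 12 : ℝ) * (weightSmallH i + weightBigH i)] j := by
    fin_cases i <;> fin_cases j <;>
      simp [rootDiagram, weightSmallH, weightBigH] <;> ring
  rw [hd, r.cartanVectors_eq]
  fin_cases j
  · simp [r.smallH_lie, r.bigH_lie, mul_smul, sub_smul]
  · simp [r.smallH_lie, r.bigH_lie, mul_smul, add_smul]

/-- Nonvanishing spreads from `S₁`: the elements `h` and `H` have nonzero eigenvalues on it, and
every other vector occurs in a bracket equal to a nonzero multiple of one already known not to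
vanish. The relations from `s5l1` to `s2l5` serve this purpose. -/
theorem rootVectors_ne_zero (r : IsG2Triple S₁ S₂ S₃ S₄ S₅ S₆ L₁ L₂ L₃ L₄ L₅ L₆ H h)
    (hne : S₁ ≠ 0) (i : Fin 12) : rootVectors S₁ S₂ S₃ i ≠ 0 := by
  have nh : h ≠ 0 := by rintro rfl; have := r.hs1.symm; simp at this; exact hne this
  have nH : H ≠ 0 := by rintro rfl; have := r.Hs1.symm; simp at this; exact hne this
  have n4 : S₄ ≠ 0 := by rintro rfl; have := r.s4s3; simp at this; exact nh this.symm
  have n3 : S₃ ≠ 0 := by rintro rfl; have := r.s4s3; simp at this; exact nh this.symm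
  have n2 : S₂ ≠ 0 := by rintro rfl; have := r.s2s6; simp at this; exact nH this.symm
  have n6 : S₆ ≠ 0 := by rintro rfl; have := r.s2s6; simp at this; exact nH this.symm
  have n5 : S₅ ≠ 0 := by rintro rfl; have := r.s5s6; simp at this; exact n3 this
  have l1 : L₁ ≠ 0 := by rintro rfl; have := r.s5l1.symm; simp at this; exact n4 this
  have l2 : L₂ ≠ 0 := by rintro rfl; have := r.s6l2.symm; simp at this; exact n4 this
  have l3 : L₃ ≠ 0 := by rintro rfl; have := r.s1l3; simp at this; exact n2 this
  have l4 : L₄ ≠ 0 := by rintro rfl; have := r.s1l4; simp at this; exact n3 this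
  have l5 : L₅ ≠ 0 := by rintro rfl; have := r.s2l5; simp at this; exact n3 this
  have l6 : L₆ ≠ 0 := by rintro rfl; have := r.s5l6.symm; simp at this; exact n6 this
  rw [r.rootVectors_eq]
  fin_cases i <;> assumption

/-- The root vectors are eigenvectors of one operator with distinct nonzero eigenvalues, and the
Cartan vectors lie in its kernel. Applying it to a linear relation isolates the root part. -/
theorem linearIndependent (r : IsG2Triple S₁ S₂ S₃ S₄ S₅ S₆ L₁ L₂ L₃ L₄ L₅ L₆ H h)
    (hne : S₁ ≠ 0) :
    LinearIndependent ℝ (Sum.elim (rootVectors S₁ S₂ S₃) (cartanVectors S₁ S₂ S₃)) := by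
  set v := rootVectors S₁ S₂ S₃ with hv
  -- The factor 10 makes the combined eigenvalues of `h` and `H` pairwise distinct as well as
  -- nonzero on the twelve roots.
  let T : Module.End ℝ V := LieAlgebra.ad ℝ V (h + (10 : ℝ) • H)
  let μ : Fin 12 → ℝ := fun i => ((weightSmallH i + 10 * weightBigH i : ℤ) : ℝ)
  have hinj : Function.Injective μ :=
    Int.cast_injective.comp
      (by decide : Function.Injective fun i => weightSmallH i + 10 * weightBigH i)
  have hμ0 (i) : μ i ≠ 0 :=
    Int.cast_ne_zero.2 ((by decide : ∀ i, weightSmallH i + 10 * weightBigH i ≠ 0) i)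
  have hT (i) : T (v i) = μ i • v i := by
    simp [T, μ, hv, r.smallH_lie, r.bigH_lie, add_smul, mul_smul]
  have hTH : T H = 0 := by
    have := r.bigH_smallH
    simp only [T, LieAlgebra.ad_apply, add_lie, smul_lie, lie_self, smul_zero, add_zero]
    rw [← lie_skew, this, neg_zero]
  have hTh : T h = 0 := by
    simp [T, r.bigH_smallH]
  have hli : LinearIndependent ℝ v :=
    Module.End.eigenvectors_linearIndependent' T μ hinj v fun i =>
      ⟨Module.End.mem_eigenspace_iff.2 (hT i), r.rootVectors_ne_zero hne i⟩
  have hTc (j) : T (cartanVectors S₁ S₂ S₃ j) = 0 := by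
    rw [r.cartanVectors_eq]
    fin_cases j <;> simp [hTh, hTH]
  rw [Fintype.linearIndependent_iff] at hli ⊢
  intro g hg
  simp only [Fintype.sum_sum_type, Sum.elim_inl, Sum.elim_inr] at hg
  have h1 := congrArg T hg
  simp only [map_add, map_sum, map_smul, hT, hTc, smul_zero, Finset.sum_const_zero, add_zero,
    map_zero, smul_smul] at h1
  have hroot (i : Fin 12) : g (Sum.inl i) = 0 := by
    simpa [hμ0] using hli (fun i => g (Sum.inl i) * μ i) h1 i
  simp only [hroot, zero_smul, Finset.sum_const_zero, zero_add, Fin.sum_univ_two] at hg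
  -- The remaining Cartan relation is bracketed with root vectors; the roots (1, 0) and (0, √3), of
  -- `S₁` and `L₂`, separate its two coefficients.
  have hc (i) := congrArg (fun w => ⁅w, v i⁆) hg
  simp only [add_lie, smul_lie, hv, r.cartanVectors_lie, zero_lie, smul_smul, ← add_smul] at hc
  have hc' (i) := (smul_eq_zero.1 (hc i)).resolve_right (r.rootVectors_ne_zero hne i)
  have c0 : g (Sum.inr 0) = 0 := by simpa [rootDiagram] using hc' 0
  have c1 : g (Sum.inr 1) = 0 := by simpa [rootDiagram, c0] using hc' 7
  rintro (i | j)
  · exact hroot i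
  · fin_cases j
    · exact c0
    · exact c1

/-- The Serre generators of the Lie algebra generated by `S₁`, `S₂`, `S₃`. -/
theorem isG2Serre (r : IsG2Triple S₁ S₂ S₃ S₄ S₅ S₆ L₁ L₂ L₃ L₄ L₅ L₆ H h) :
    IsG2Serre S₁ L₃ ((1 / 2 : ℝ) • S₅) ((1 / 36 : ℝ) • L₆) ((1 / 2 : ℝ) • (h - H))
      ((1 / 6 : ℝ) • ((2 : ℝ) • H - h)) := by
  -- The roots of `S₁` (short) and `L₃` (long) form an angle of 150° and serve as simple roots; `S₅`
  -- and `L₆` have the opposite roots. The factors 1/2 and 1/36 make each coroot act by 2 on its own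
  -- root vector.
  have hw := r.smallH_lie
  have Hw := r.bigH_lie
  rw [r.rootVectors_eq] at hw Hw
  have h1 := hw 0
  have h3 := hw 8
  have h5 := hw 4
  have h6 := hw 11
  have H1 := Hw 0
  have H3 := Hw 8
  have H5 := Hw 4
  have H6 := Hw 11
  simp [weightSmallH, weightBigH] at h1 h3 h5 h6 H1 H3 H5 H6
  have hH : ⁅h, H⁆ = 0 := by rw [← lie_skew, r.bigH_smallH, neg_zero]
  have s1s5 : ⁅S₁, S₅⁆ = h - H := by
    rw [← r.s2s3, leibniz_lie, r.s1s2, r.s4s3, ← lie_skew S₁ S₃, r.s3s1, lie_neg, r.s2s6,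
      sub_eq_add_neg]
  have l3s1 : ⁅L₃, S₁⁆ = (6 : ℝ) • S₂ := by rw [← lie_skew, r.s1l3]; module
  have l6s5 : ⁅L₆, S₅⁆ = (-6 : ℝ) • S₆ := by rw [← lie_skew, r.s5l6]; module
  have l3s2 : ⁅L₃, S₂⁆ = 0 := by rw [← lie_skew, r.s2l3, neg_zero]
  have s5s3 : ⁅S₅, S₃⁆ = -L₄ := by rw [← lie_skew, r.s3s5]
  constructor
  · simp [r.bigH_smallH, hH]
  · simp [s1s5]
  · simp only [lie_smul, r.l3l6]; module
  · simp [r.s1l6]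
  · simp [r.l3s5]
  · simp only [sub_lie, smul_lie, h1, H1]; module
  · simp only [sub_lie, smul_lie, h3, H3]; module
  · simp only [sub_lie, smul_lie, h1, H1]; module
  · simp only [sub_lie, smul_lie, h3, H3]; module
  · simp only [sub_lie, smul_lie, lie_smul, h5, H5]; module
  · simp only [sub_lie, smul_lie, lie_smul, h6, H6]; module
  · simp only [sub_lie, smul_lie, lie_smul, h5, H5]; module
  · simp only [sub_lie, smul_lie, lie_smul, h6, H6]; module
  · simp [r.s1l3, r.s1s2, r.s1s4, r.s1l1]
  · simp [l3s1, l3s2]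
  · simp [r.s5l6, r.s5s6, s5s3, r.s5l4]
  · simp [l6s5, r.l6s6]

/-- The span of the fourteen vectors lies in the generated algebra, which lies in the range of `ψ`
because the Serre generators recover `S₂`, `S₆` and then `S₃`. The range lies in that span because
𝔤₂ is spanned by iterated brackets whose images are computed. The three spaces thus coincide, and 14
≤ dim 𝔤₂ ≤ 14 gives injectivity. -/
theorem splitG2_aux (r : IsG2Triple S₁ S₂ S₃ S₄ S₅ S₆ L₁ L₂ L₃ L₄ L₅ L₆ H h) (hne : S₁ ≠ 0) :
    ∃ ψ : LieAlgebra.g₂ ℝ →ₗ⁅ℝ⁆ V, Function.Injective ψ ∧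
      ψ.range = LieSubalgebra.lieSpan ℝ V {S₁, S₂, S₃} ∧
      Submodule.span ℝ (Set.range (Sum.elim (rootVectors S₁ S₂ S₃) (cartanVectors S₁ S₂ S₃))) =
        (LieSubalgebra.lieSpan ℝ V {S₁, S₂, S₃}).toSubmodule := by
  obtain ⟨ψ, he₀, he₁, hf₀, hf₁⟩ := r.isG2Serre.exists_hom
  have hs := isG2Serre_g2Gen
  have hh₀ := congrArg ψ hs.e0f0
  have hh₁ := congrArg ψ hs.e1f1
  rw [ψ.map_lie, he₀, hf₀, r.isG2Serre.e0f0] at hh₀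
  rw [ψ.map_lie, he₁, hf₁, r.isG2Serre.e1f1] at hh₁
  set N := LieSubalgebra.lieSpan ℝ V {S₁, S₂, S₃} with hN
  set W := Submodule.span ℝ
    (Set.range (Sum.elim (rootVectors S₁ S₂ S₃) (cartanVectors S₁ S₂ S₃))) with hW
  have hli := r.linearIndependent hne
  have hroot (i) : rootVectors S₁ S₂ S₃ i ∈ W := Submodule.subset_span ⟨Sum.inl i, rfl⟩
  have hcart (j) : cartanVectors S₁ S₂ S₃ j ∈ W := Submodule.subset_span ⟨Sum.inr j, rfl⟩
  have hspan := hs.serreSpan_eq_top g2_subalgebra_eq_top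
  -- the three inclusions
  have hWN : W ≤ N.toSubmodule := by
    have n1 : S₁ ∈ N := LieSubalgebra.subset_lieSpan (by simp)
    have n2 : S₂ ∈ N := LieSubalgebra.subset_lieSpan (by simp)
    have n3 : S₃ ∈ N := LieSubalgebra.subset_lieSpan (by simp)
    have n4 : S₄ ∈ N := r.s1s2 ▸ N.lie_mem n1 n2
    have n5 : S₅ ∈ N := r.s2s3 ▸ N.lie_mem n2 n3
    have n6 : S₆ ∈ N := r.s3s1 ▸ N.lie_mem n3 n1
    have l1 : L₁ ∈ N := r.s1s4 ▸ N.lie_mem n1 n4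
    have l2 : L₂ ∈ N := r.s2s4 ▸ N.lie_mem n2 n4
    have l3 : L₃ ∈ N := r.s2s5 ▸ N.lie_mem n2 n5
    have l4 : L₄ ∈ N := r.s3s5 ▸ N.lie_mem n3 n5
    have l5 : L₅ ∈ N := r.s3s6 ▸ N.lie_mem n3 n6
    have l6 : L₆ ∈ N := r.s1s6 ▸ N.lie_mem n1 n6
    have nH : H ∈ N := r.s2s6 ▸ N.lie_mem n2 n6
    have nh : h ∈ N := r.s4s3 ▸ N.lie_mem n4 n3
    rw [hW, Submodule.span_le]
    rintro _ ⟨i | j, rfl⟩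
    · simp only [Sum.elim_inl, r.rootVectors_eq]
      fin_cases i <;> assumption
    · simp only [Sum.elim_inr, r.cartanVectors_eq]
      fin_cases j
      · exact N.smul_mem _ (sub_mem nh nH)
      · exact N.smul_mem _ (add_mem nh nH)
  have hNψ : N ≤ ψ.range := by
    have m1 : S₁ ∈ ψ.range := ⟨_, he₀⟩
    have ml3 : L₃ ∈ ψ.range := ⟨_, he₁⟩
    have m2 : S₂ ∈ ψ.range := by
      have := ψ.range.smul_mem (-(1 / 6) : ℝ) (ψ.range.lie_mem m1 ml3)
      rw [r.s1l3] at this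
      convert this using 1
      module
    have m5 : S₅ ∈ ψ.range := by
      have := ψ.range.smul_mem (2 : ℝ) (⟨_, hf₀⟩ : _ ∈ ψ.range)
      convert this using 1
      module
    have ml6 : L₆ ∈ ψ.range := by
      have := ψ.range.smul_mem (36 : ℝ) (⟨_, hf₁⟩ : _ ∈ ψ.range)
      convert this using 1
      module
    have m6 : S₆ ∈ ψ.range := by
      have := ψ.range.smul_mem (1 / 6 : ℝ) (ψ.range.lie_mem m5 ml6)
      rw [r.s5l6] at this
      convert this using 1
      module
    have m3 : S₃ ∈ ψ.range := by
      have := ψ.range.smul_mem (-(1 / 8) : ℝ) (ψ.range.lie_mem m5 m6)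
      rw [r.s5s6] at this
      convert this using 1
      module
    rw [hN, LieSubalgebra.lieSpan_le]
    rintro _ (rfl | rfl | rfl) <;> assumption
  have hψW : ψ.range.toSubmodule ≤ W := by
    have hr : ψ.range.toSubmodule = (⊤ : Submodule ℝ _).map (ψ : LieAlgebra.g₂ ℝ →ₗ[ℝ] V) := by
      rw [Submodule.map_top, LieHom.range_toSubmodule]
    rw [r.rootVectors_eq] at hroot
    rw [r.cartanVectors_eq] at hcart
    have w1 : S₁ ∈ W := hroot 0
    have w2 : S₂ ∈ W := hroot 1
    have w3 : S₃ ∈ W := hroot 2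
    have w4 : S₄ ∈ W := hroot 3
    have w5 : S₅ ∈ W := hroot 4
    have w6 : S₆ ∈ W := hroot 5
    have wl1 : L₁ ∈ W := hroot 6
    have wl2 : L₂ ∈ W := hroot 7
    have wl3 : L₃ ∈ W := hroot 8
    have wl4 : L₄ ∈ W := hroot 9
    have wl5 : L₅ ∈ W := hroot 10
    have wl6 : L₆ ∈ W := hroot 11
    have wc0 : (1 / 4 : ℝ) • (h - H) ∈ W := hcart 0
    have wc1 : (√3 / 12 : ℝ) • (h + H) ∈ W := hcart 1
    have hsm (a : ℝ) {x : V} (hx : x ∈ W) : a • x ∈ W := W.smul_mem a hx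
    have hng {x : V} (hx : x ∈ W) : -x ∈ W := neg_mem hx
    have wadd : h + H ∈ W := by
      have := hsm (4 * √3) wc1
      rw [smul_smul, show 4 * √3 * (√3 / 12) = (1 : ℝ) by
        rw [show 4 * √3 * (√3 / 12) = √3 * √3 / 3 by ring, Real.mul_self_sqrt] <;> norm_num,
        one_smul] at this
      exact this
    have wsub : h - H ∈ W := by
      have := hsm 4 wc0
      rwa [smul_smul, show (4 : ℝ) * (1 / 4) = 1 by norm_num, one_smul] at this
    have s5s3 : ⁅S₅, S₃⁆ = -L₄ := by rw [← lie_skew, r.s3s5]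
    have l6l4 : ⁅L₆, L₄⁆ = (-6 : ℝ) • L₅ := by rw [← lie_skew, r.l4l6]; module
    rw [hr, ← hspan, serreSpan, Submodule.map_span_le]
    rintro _ ((⟨i, rfl⟩ | ⟨i, rfl⟩) | rfl | rfl)
    · fin_cases i
      · simpa [upperRootVectors, he₀]
      · simpa [upperRootVectors, he₁]
      · simpa [upperRootVectors, he₀, he₁, r.s1l3] using hsm _ w2
      · simpa [upperRootVectors, he₀, he₁, r.s1l3, r.s1s2] using hsm _ w4
      · simpa [upperRootVectors, he₀, he₁, r.s1l3, r.s1s2, r.s1s4] using hsm _ wl1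
      · simpa [upperRootVectors, he₀, he₁, r.s1l3, r.s1s2, r.s1s4, r.l3l1] using
          hsm _ (hsm _ wl2)
    · fin_cases i
      · simpa [upperRootVectors, hf₀] using w5
      · simpa [upperRootVectors, hf₁] using hsm _ wl6
      · simpa [upperRootVectors, hf₀, hf₁, r.s5l6] using hsm _ (hsm _ (hsm _ w6))
      · simpa [upperRootVectors, hf₀, hf₁, r.s5l6, r.s5s6] using
          hsm _ (hsm _ (hsm _ (hsm _ (hsm _ w3))))
      · simpa [upperRootVectors, hf₀, hf₁, r.s5l6, r.s5s6, s5s3] using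
          hsm _ (hsm _ (hsm _ (hsm _ (hsm _ (hsm _ wl4)))))
      · simpa [upperRootVectors, hf₀, hf₁, r.s5l6, r.s5s6, s5s3, l6l4] using
          hsm _ (hsm _ (hsm _ (hsm _ (hsm _ (hsm _ (hsm _ (hsm _ wl5)))))))
    · change ψ _ ∈ W
      rw [← hh₀]
      exact hsm _ wsub
    · change ψ _ ∈ W
      rw [← hh₁]
      convert sub_mem (hsm (1 / 12) wadd) (hsm (1 / 4) wsub) using 1
      module
  have hψN : ψ.range = N :=
    le_antisymm (fun x hx => hWN (hψW hx)) hNψ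
  have hWN' : W = N.toSubmodule := le_antisymm hWN fun x hx => hψW (hNψ hx)
  refine ⟨ψ, ?_, hψN, hWN'⟩
  -- injectivity by comparison of dimensions
  have htop : (⊤ : Submodule ℝ (LieAlgebra.g₂ ℝ)) = Submodule.span ℝ (Set.range (Sum.elim (Sum.elim
      (upperRootVectors (g2Gen (.E 0)) (g2Gen (.E 1)))
      (upperRootVectors (g2Gen (.F 0)) (g2Gen (.F 1)))) ![g2Gen (.H 0), g2Gen (.H 1)])) := by
    rw [← hspan, serreSpan, Set.Sum.elim_range, Set.Sum.elim_range, Matrix.range_cons,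
      Matrix.range_cons, Matrix.range_empty, Set.union_empty, Set.singleton_union]
  have hfin : FiniteDimensional ℝ (LieAlgebra.g₂ ℝ) :=
    ⟨htop ▸ Submodule.fg_span (Set.finite_range _)⟩
  have hle : Module.finrank ℝ (LieAlgebra.g₂ ℝ) ≤ 14 := by
    rw [← finrank_top, htop]
    exact finrank_range_le_card _
  have hrange : Module.finrank ℝ (LinearMap.range (ψ : LieAlgebra.g₂ ℝ →ₗ[ℝ] V)) = 14 := by
    rw [← LieHom.range_toSubmodule, hψN, ← hWN', hW, finrank_span_eq_card hli]
    rfl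
  have hker := LinearMap.finrank_range_add_finrank_ker (ψ : LieAlgebra.g₂ ℝ →ₗ[ℝ] V)
  have hk : LinearMap.ker (ψ : LieAlgebra.g₂ ℝ →ₗ[ℝ] V) = ⊥ :=
    Submodule.finrank_eq_zero.1 (by omega)
  exact LinearMap.ker_eq_bot.1 hk

/-- The span of the Cartan vectors is abelian, hence nilpotent. It is its own normaliser because no
root vanishes on both Cartan vectors, so an element of the normaliser has no component along any
root vector. -/
theorem cartan (r : IsG2Triple S₁ S₂ S₃ S₄ S₅ S₆ L₁ L₂ L₃ L₄ L₅ L₆ H h) (hne : S₁ ≠ 0) :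
    ∃ 𝔥 : LieSubalgebra ℝ (LieSubalgebra.lieSpan ℝ V {S₁, S₂, S₃}),
    𝔥.IsCartanSubalgebra ∧
      𝔥.toSubmodule.map (LieSubalgebra.lieSpan ℝ V {S₁, S₂, S₃}).toSubmodule.subtype =
        Submodule.span ℝ (Set.range (cartanVectors S₁ S₂ S₃)) := by
  obtain ⟨-, -, -, hspan⟩ := r.splitG2_aux hne
  have hli := r.linearIndependent hne
  set N := LieSubalgebra.lieSpan ℝ V {S₁, S₂, S₃} with hN
  set C := Submodule.span ℝ (Set.range (cartanVectors S₁ S₂ S₃)) with hC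
  have hCN : C ≤ N.toSubmodule := by
    rw [← hspan, hC]
    refine Submodule.span_mono ?_
    rw [Set.Sum.elim_range]
    exact Set.subset_union_right
  have hcc (i j) : ⁅cartanVectors S₁ S₂ S₃ i, cartanVectors S₁ S₂ S₃ j⁆ = 0 := by
    have hH : ⁅h, H⁆ = 0 := by rw [← lie_skew, r.bigH_smallH, neg_zero]
    rw [r.cartanVectors_eq]
    fin_cases i <;> fin_cases j <;> simp [r.bigH_smallH, hH]
  have hcomm (x) (hx : x ∈ C) (y) (hy : y ∈ C) : ⁅x, y⁆ = 0 := by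
    induction hx, hy using Submodule.span_induction₂ with
    | mem_mem x y hx hy =>
      obtain ⟨i, rfl⟩ := hx
      obtain ⟨j, rfl⟩ := hy
      exact hcc i j
    | zero_left => simp
    | zero_right => simp
    | add_left x y z _ _ _ hx hy => rw [add_lie, hx, hy, add_zero]
    | add_right x y z _ _ _ hx hy => rw [lie_add, hx, hy, add_zero]
    | smul_left a x y _ _ hx => rw [smul_lie, hx, smul_zero]
    | smul_right a x y _ _ hx => rw [lie_smul, hx, smul_zero]
  let 𝔥 : LieSubalgebra ℝ N :=
    { C.comap N.toSubmodule.subtype with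
      lie_mem' := by
        intro x y hx hy
        change ((⁅x, y⁆ : N) : V) ∈ C
        rw [LieSubalgebra.coe_bracket, show ⁅(x : V), (y : V)⁆ = 0 from hcomm _ hx _ hy]
        exact C.zero_mem }
  have hmem (x : N) : x ∈ 𝔥 ↔ (x : V) ∈ C := Iff.rfl
  refine ⟨𝔥, ⟨?_, ?_⟩, ?_⟩
  · have : IsLieAbelian 𝔥 := ⟨fun x y => by
      apply Subtype.ext
      apply Subtype.ext
      exact hcomm _ x.2 _ y.2⟩
    infer_instance
  · refine le_antisymm (fun x hx => ?_) 𝔥.le_normalizer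
    rw [LieSubalgebra.mem_normalizer_iff'] at hx
    have hxs : (x : V) ∈ N.toSubmodule := x.2
    rw [← hspan, Submodule.mem_span_range_iff_exists_fun] at hxs
    obtain ⟨a, ha⟩ := hxs
    simp only [Fintype.sum_sum_type, Sum.elim_inl, Sum.elim_inr] at ha
    have hcart (j) : cartanVectors S₁ S₂ S₃ j ∈ C := Submodule.subset_span ⟨j, rfl⟩
    have hz (i) (j) : a (Sum.inl i) * rootDiagram i j = 0 := by
      have hj : ⁅cartanVectors S₁ S₂ S₃ j, (x : V)⁆ ∈ C :=
        hx ⟨cartanVectors S₁ S₂ S₃ j, hCN (hcart j)⟩ (hcart j)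
      rw [← ha, lie_add, hcomm _ (hcart j) _ (C.sum_mem fun k _ => C.smul_mem _ (hcart k)),
        add_zero] at hj
      simp only [lie_sum, lie_smul, r.cartanVectors_lie, smul_smul] at hj
      rw [hC, Submodule.mem_span_range_iff_exists_fun] at hj
      obtain ⟨b, hb⟩ := hj
      rw [Fintype.linearIndependent_iff] at hli
      have := hli (Sum.elim (fun i => a (Sum.inl i) * rootDiagram i j) (fun k => -b k)) (by
        simp only [Fintype.sum_sum_type, Sum.elim_inl, Sum.elim_inr, neg_smul,
          Finset.sum_neg_distrib, hb, add_neg_cancel]) (Sum.inl i)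
      exact this
    have hnz (i) : rootDiagram i 0 ≠ 0 ∨ rootDiagram i 1 ≠ 0 := by
      fin_cases i <;> simp [rootDiagram]
    have ha0 (i) : a (Sum.inl i) = 0 := by
      rcases hnz i with h' | h'
      · exact (mul_eq_zero.1 (hz i 0)).resolve_right h'
      · exact (mul_eq_zero.1 (hz i 1)).resolve_right h'
    rw [hmem, ← ha]
    simp only [ha0, zero_smul, Finset.sum_const_zero, zero_add]
    exact C.sum_mem fun k _ => C.smul_mem _ (hcart k)
  · change (C.comap N.toSubmodule.subtype).map N.toSubmodule.subtype = C
    rw [Submodule.map_comap_subtype, inf_eq_right.2 hCN]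

theorem pairwiseBracketGeneratesSplitG2
    (r : IsG2Triple S₁ S₂ S₃ S₄ S₅ S₆ L₁ L₂ L₃ L₄ L₅ L₆ H h) (hne : S₁ ≠ 0) :
    PairwiseBracketGeneratesSplitG2 S₁ S₂ S₃ := by
  obtain ⟨ψ, hinj, hrange, hspan⟩ := r.splitG2_aux hne
  exact ⟨r.linearIndependent hne, hspan,
    ⟨((LieEquiv.ofInjective ψ hinj).trans (LieEquiv.ofEq _ _ (congrArg _ hrange))).symm⟩,
    r.cartan hne, r.cartanVectors_lie⟩

end IsG2Triple
end Triple

/-! ### The flat fields as derivations of the polynomial ring -/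

section FlatModel

open MvPolynomial

/-- Polynomial vector fields on `ℝ⁵`. -/
abbrev PolyField := Derivation ℝ (MvPolynomial (Fin 5) ℝ) (MvPolynomial (Fin 5) ℝ)

/-- The field `S¹` on flat space, as a derivation. -/
noncomputable def polyS1 : PolyField :=
  mkDerivation ℝ ![4 * X 2 - 2 * X 3 * X 4, 2 * X 4 ^ 2, -X 4, 1, 0]

/-- The field `S²` on flat space, as a derivation. -/
noncomputable def polyS2 : PolyField :=
  mkDerivation ℝ ![2 * X 3 ^ 2, -2 * X 3 * X 4 - 4 * X 2, X 3, 0, 1]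

/-- The field `S³` on flat space, as a derivation. -/
noncomputable def polyS3 : PolyField :=
  mkDerivation ℝ
    ![2 * X 2 ^ 2 * X 3 + 2 * X 1 * X 3 ^ 2 + 2 * X 0 * X 3 * X 4 - 4 * X 0 * X 2,
      -2 * X 2 ^ 2 * X 4 - 2 * X 1 * X 3 * X 4 - 4 * X 1 * X 2 - 2 * X 0 * X 4 ^ 2,
      -X 2 ^ 2 + X 1 * X 3 + X 0 * X 4, -X 0, X 1]

/-- The field `S⁴` on flat space. -/
noncomputable def polyS4 : PolyField := mkDerivation ℝ ![2 * X 3, -2 * X 4, 2, 0, 0]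

/-- The field `S⁵` on flat space. -/
noncomputable def polyS5 : PolyField :=
  mkDerivation ℝ
    ![-12 * X 2 * X 3 ^ 2 + 2 * X 0 * X 3,
      12 * X 2 * X 3 * X 4 + 10 * X 2 ^ 2 - 2 * X 0 * X 4,
      -6 * X 2 * X 3 + 2 * X 0, -2 * X 3 ^ 2, -2 * X 3 * X 4 - 4 * X 2]

/-- The field `S⁶` on flat space. -/
noncomputable def polyS6 : PolyField :=
  mkDerivation ℝ
    ![-12 * X 2 * X 3 * X 4 + 10 * X 2 ^ 2 - 2 * X 1 * X 3,
      12 * X 2 * X 4 ^ 2 + 2 * X 1 * X 4,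
      -6 * X 2 * X 4 - 2 * X 1, -2 * X 3 * X 4 + 4 * X 2, -2 * X 4 ^ 2]

/-- The field `L¹` on flat space. -/
noncomputable def polyL1 : PolyField := mkDerivation ℝ ![-6, 0, 0, 0, 0]

/-- The field `L²` on flat space. -/
noncomputable def polyL2 : PolyField := mkDerivation ℝ ![0, 6, 0, 0, 0]

/-- The field `L³` on flat space. -/
noncomputable def polyL3 : PolyField := mkDerivation ℝ ![0, 6 * X 0, 0, 0, -6 * X 3]

/-- The field `L⁴` on flat space. -/
noncomputable def polyL4 : PolyField :=
  mkDerivation ℝ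
    ![-24 * X 2 ^ 2 * X 3 ^ 2 + 6 * X 0 ^ 2,
      24 * X 2 ^ 2 * X 3 * X 4 + 12 * X 2 ^ 3 + 6 * X 0 * X 1,
      -12 * X 2 ^ 2 * X 3 + 6 * X 0 * X 2, -12 * X 2 * X 3 ^ 2 + 6 * X 0 * X 3,
      -12 * X 2 * X 3 * X 4 - 6 * X 2 ^ 2 - 6 * X 1 * X 3]

/-- The field `L⁵` on flat space. -/
noncomputable def polyL5 : PolyField :=
  mkDerivation ℝ
    ![-24 * X 2 ^ 2 * X 3 * X 4 + 12 * X 2 ^ 3 - 6 * X 0 * X 1,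
      24 * X 2 ^ 2 * X 4 ^ 2 - 6 * X 1 ^ 2,
      -12 * X 2 ^ 2 * X 4 - 6 * X 1 * X 2,
      -12 * X 2 * X 3 * X 4 + 6 * X 2 ^ 2 + 6 * X 0 * X 4,
      -12 * X 2 * X 4 ^ 2 - 6 * X 1 * X 4]

/-- The field `L⁶` on flat space. -/
noncomputable def polyL6 : PolyField := mkDerivation ℝ ![6 * X 1, 0, 0, -6 * X 4, 0]

/-- The field `H` on flat space. -/
noncomputable def polyBigH : PolyField :=
  mkDerivation ℝ ![0, -6 * X 1, -2 * X 2, 2 * X 3, -4 * X 4]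

/-- The field `h` on flat space. -/
noncomputable def polySmallH : PolyField :=
  mkDerivation ℝ ![-6 * X 0, -6 * X 1, -4 * X 2, -2 * X 3, -2 * X 4]

theorem derivation_ofNat (D : PolyField) (n : ℕ) [n.AtLeastTwo] :
    D (ofNat(n) : MvPolynomial (Fin 5) ℝ) = 0 := by
  rw [← Nat.cast_ofNat (R := MvPolynomial (Fin 5) ℝ)]
  exact D.map_natCast _

theorem real_ofNat_smul (n : ℕ) [n.AtLeastTwo] (p : MvPolynomial (Fin 5) ℝ) :
    (ofNat(n) : ℝ) • p = ofNat(n) * p := by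
  rw [Algebra.smul_def, map_ofNat]

-- A derivation of the polynomial ring is determined by its values on the five variables, so every
-- relation amounts to five polynomial identities.
set_option maxHeartbeats 4000000 in
theorem isG2Triple_poly : IsG2Triple polyS1 polyS2 polyS3 polyS4 polyS5 polyS6
    polyL1 polyL2 polyL3 polyL4 polyL5 polyL6 polyBigH polySmallH := by
  constructor
  all_goals
    apply derivation_ext
    intro i
    rw [Derivation.commutator_apply]
    fin_cases i
  all_goals
    simp [polyS1, polyS2, polyS3, polyS4, polyS5, polyS6, polyL1, polyL2, polyL3, polyL4, polyL5,
      polyL6, polyBigH, polySmallH, mkDerivation_X, Derivation.leibniz, Derivation.leibniz_pow,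
      derivation_ofNat, real_ofNat_smul]
  all_goals ring

end FlatModel

/-! ### Pulling polynomial vector fields back along a local diffeomorphism -/

section Pullback

open MvPolynomial

/-- The vector field on `ℝ⁵` defined by a derivation. -/
noncomputable def polyVectorField (D : PolyField) (c : Fin 5 → ℝ) : Fin 5 → ℝ :=
  fun i => eval c (D (X i))

theorem contDiff_eval (p : MvPolynomial (Fin 5) ℝ) :
    ContDiff ℝ ∞ fun c : Fin 5 → ℝ => eval c p := by
  induction p using MvPolynomial.induction_on with
  | C a => simpa using! contDiff_const
  | add p q hp hq => simpa using hp.add hq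
  | mul_X p i hp => simpa using hp.mul (contDiff_apply ℝ ℝ i)

theorem contDiff_polyVectorField (D : PolyField) : ContDiff ℝ ∞ (polyVectorField D) :=
  contDiff_pi.2 fun i => contDiff_eval (D (X i))

/-- Both sides obey the Leibniz rule and agree on constants and variables. This links the algebraic
derivation to the analytic directional derivative. -/
theorem fderiv_eval_polyVectorField (D : PolyField) (p : MvPolynomial (Fin 5) ℝ)
    (c : Fin 5 → ℝ) :
    fderiv ℝ (fun c : Fin 5 → ℝ => eval c p) c (polyVectorField D c) = eval c (D p) := by
  have hd (p : MvPolynomial (Fin 5) ℝ) : DifferentiableAt ℝ (fun c : Fin 5 → ℝ => eval c p) c :=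
    (contDiff_eval p).differentiable (by simp) c
  induction p using MvPolynomial.induction_on with
  | C a => simp
  | add p q hp hq =>
    simp only [map_add]
    rw [fderiv_fun_add (hd p) (hd q), add_apply, hp, hq]
  | mul_X p i hp =>
    simp only [map_mul, eval_X]
    have hi : HasFDerivAt (fun c : Fin 5 → ℝ => c i)
      (ContinuousLinearMap.proj (R := ℝ) (φ := fun _ : Fin 5 => ℝ) i) c := hasFDerivAt_apply i c
    rw [fderiv_fun_mul (hd p) hi.differentiableAt, hi.fderiv]
    simp [hp, Derivation.leibniz, polyVectorField]

/-- The convention `[V, W] = DW(V) - DV(W)` matches the commutator D₁D₂ - D₂D₁ without a change of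
sign. -/
theorem polyVectorField_lie (D₁ D₂ : PolyField) (c : Fin 5 → ℝ) :
    polyVectorField ⁅D₁, D₂⁆ c =
      VectorField.lieBracket ℝ (polyVectorField D₁) (polyVectorField D₂) c := by
  have hd (D : PolyField) (i : Fin 5) :
      DifferentiableAt ℝ (fun c => polyVectorField D c i) c :=
    (contDiff_eval (D (X i))).differentiable (by simp) c
  have hf (D D' : PolyField) (i : Fin 5) :
      fderiv ℝ (polyVectorField D) c (polyVectorField D' c) i = eval c (D' (D (X i))) := by
    rw [fderiv_pi (φ := fun i c => polyVectorField D c i) (hd D)]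
    exact fderiv_eval_polyVectorField D' (D (X i)) c
  funext i
  rw [VectorField.lieBracket, Pi.sub_apply, hf, hf, polyVectorField, Derivation.commutator_apply,
    map_sub]

variable {U : TopologicalSpace.Opens (Fin 5 → ℝ)} {Φ : (Fin 5 → ℝ) → Fin 5 → ℝ}

open Classical in
/-- The pullback to `U`, extended by zero, of a polynomial vector field along a smooth map with
invertible differential. -/
noncomputable def pullbackPolyField (hΦ : ContDiffOn ℝ ∞ Φ U)
    (hinv : ∀ m ∈ U, (fderiv ℝ Φ m).IsInvertible) : PolyField →ₗ⁅ℝ⁆ smoothVectorFields U where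
  toFun D := ⟨fun m => if m ∈ U then VectorField.pullback ℝ Φ (polyVectorField D) m else 0, by
    refine ⟨?_, fun m hm => if_neg hm⟩
    have h : ContDiffOn ℝ ∞ (VectorField.pullback ℝ Φ (polyVectorField D)) U := by
      intro m hm
      have hm' : m ∈ U := hm
      have hc := hΦ.contDiffAt (U.isOpen.mem_nhds hm')
      -- Inversion of linear maps is smooth near an invertible one, so the inverse differential
      -- depends smoothly on the point.
      have h1 : ContDiffAt ℝ ∞ (fun m => (fderiv ℝ Φ m).inverse) m := by
        obtain ⟨e, he⟩ := hinv m hm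
        have := contDiffAt_map_inverse (n := ∞) e
        rw [he] at this
        exact this.comp m (hc.fderiv_right (by simp))
      exact (h1.clm_apply ((contDiff_polyVectorField D).contDiffAt.comp m hc)).contDiffWithinAt
    exact h.congr fun m hm => if_pos hm⟩
  map_add' D D' := ext_on fun m hm => by
    have hm' : m ∈ U := hm
    have : polyVectorField (D + D') (Φ m) = polyVectorField D (Φ m) + polyVectorField D' (Φ m) := by
      funext i; simp [polyVectorField]
    simp [hm', VectorField.pullback, this]
  map_smul' a D := ext_on fun m hm => by
    have hm' : m ∈ U := hm
    have : polyVectorField (a • D) (Φ m) = a • polyVectorField D (Φ m) := by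
      funext i; simp [polyVectorField]
    simp [hm', VectorField.pullback, this]
  map_lie' {D D'} := ext_on fun m hm => by
    have hm' : m ∈ U := hm
    have hc := hΦ.contDiffAt (U.isOpen.mem_nhds hm')
    have heq (D : PolyField) : (fun m => if m ∈ U then
        VectorField.pullback ℝ Φ (polyVectorField D) m else 0) =ᶠ[nhds m]
        VectorField.pullback ℝ Φ (polyVectorField D) := by
      filter_upwards [U.isOpen.mem_nhds hm'] with a ha using if_pos ha
    rw [bracket_apply _ _ hm]
    change (if m ∈ U then _ else _) = _
    rw [if_pos hm', (heq D).lieBracket_vectorField_eq (heq D'),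
      ← VectorField.pullback_lieBracket (n := ∞) (by simpa using ENat.LEInfty.out) hc
        ((contDiff_polyVectorField D).differentiable (by simp) _)
        ((contDiff_polyVectorField D').differentiable (by simp) _)]
    simp only [VectorField.pullback, polyVectorField_lie]

theorem pullbackPolyField_apply (hΦ : ContDiffOn ℝ ∞ Φ U)
    (hinv : ∀ m ∈ U, (fderiv ℝ Φ m).IsInvertible) (D : PolyField) {m : Fin 5 → ℝ} (hm : m ∈ U) :
    (pullbackPolyField hΦ hinv D).1 m = VectorField.pullback ℝ Φ (polyVectorField D) m :=
  if_pos hm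

theorem polyVectorField_polyS1 : polyVectorField polyS1 = flatS1 := by
  funext c i
  fin_cases i <;>
    simp [polyVectorField, polyS1, flatS1, flatZ1, flatZ2, partialVec, mkDerivation_X] <;> ring

theorem polyVectorField_polyS2 : polyVectorField polyS2 = flatS2 := by
  funext c i
  fin_cases i <;>
    simp [polyVectorField, polyS2, flatS2, flatZ1, flatZ3, partialVec, mkDerivation_X] <;> ring

theorem polyVectorField_polyS3 : polyVectorField polyS3 = flatS3 := by
  funext c i
  fin_cases i <;>
    simp [polyVectorField, polyS3, flatS3, flatZ1, flatZ2, flatZ3, partialVec,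
      mkDerivation_X] <;> ring

/-- Smooth fields that a local diffeomorphism maps to the flat fields pairwise bracket-generate
split `𝔤₂`. -/
theorem exists_pairwiseBracketGeneratesSplitG2 (hU : (U : Set (Fin 5 → ℝ)).Nonempty)
    (hΦ : ContDiffOn ℝ ∞ Φ U) (hinv : ∀ m ∈ U, (fderiv ℝ Φ m).IsInvertible)
    {V₁ V₂ V₃ : (Fin 5 → ℝ) → Fin 5 → ℝ}
    (h₁ : ∀ m ∈ U, fderiv ℝ Φ m (V₁ m) = flatS1 (Φ m))
    (h₂ : ∀ m ∈ U, fderiv ℝ Φ m (V₂ m) = flatS2 (Φ m))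
    (h₃ : ∀ m ∈ U, fderiv ℝ Φ m (V₃ m) = flatS3 (Φ m)) :
    ∃ s₁ s₂ s₃ : smoothVectorFields U, Set.EqOn s₁.1 V₁ U ∧ Set.EqOn s₂.1 V₂ U ∧
      Set.EqOn s₃.1 V₃ U ∧ PairwiseBracketGeneratesSplitG2 s₁ s₂ s₃ := by
  -- Since the differential is invertible, a field mapped to a given flat field must be its
  -- pullback.
  have heq {D : PolyField} {V : (Fin 5 → ℝ) → Fin 5 → ℝ}
      (h : ∀ m ∈ U, fderiv ℝ Φ m (V m) = polyVectorField D (Φ m)) :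
      Set.EqOn (pullbackPolyField hΦ hinv D).1 V U := by
    intro m hm
    rw [pullbackPolyField_apply hΦ hinv D hm, VectorField.pullback, ← h m hm]
    obtain ⟨e, he⟩ := hinv m hm
    rw [← he]
    simp
  refine ⟨pullbackPolyField hΦ hinv polyS1, pullbackPolyField hΦ hinv polyS2,
    pullbackPolyField hΦ hinv polyS3, heq (by rwa [polyVectorField_polyS1]),
    heq (by rwa [polyVectorField_polyS2]), heq (by rwa [polyVectorField_polyS3]),
    (isG2Triple_poly.map (pullbackPolyField hΦ hinv)).pairwiseBracketGeneratesSplitG2 ?_⟩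
  -- The c₄-component (index 3) of the first flat field is constantly 1, so its pullback is nonzero
  -- at any point of `U`.
  intro h0
  obtain ⟨m, hm⟩ := hU
  have hm' : m ∈ U := hm
  have h1 := VectorField.fderiv_pullback Φ (polyVectorField polyS1) m (hinv m hm')
  rw [← pullbackPolyField_apply hΦ hinv polyS1 hm', h0] at h1
  have h2 := congrFun h1 3
  simp [polyVectorField, polyS1, mkDerivation_X] at h2

end Pullback

/-! ### Directional derivatives -/

section DirDeriv

variable {f g : (Fin 5 → ℝ) → ℝ} {m v : Fin 5 → ℝ} {d e : ℝ}

/-- `f` is differentiable at `m`, with derivative `d` in the direction `v`. -/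
def HasDirDerivAt (f : (Fin 5 → ℝ) → ℝ) (m v : Fin 5 → ℝ) (d : ℝ) : Prop :=
  ∃ L : (Fin 5 → ℝ) →L[ℝ] ℝ, HasFDerivAt f L m ∧ L v = d

namespace HasDirDerivAt

theorem coord (i : Fin 5) : HasDirDerivAt (fun m => m i) m v (v i) :=
  ⟨ContinuousLinearMap.proj (R := ℝ) (φ := fun _ : Fin 5 => ℝ) i, hasFDerivAt_apply i m, rfl⟩

theorem comp_coord {h : ℝ → ℝ} {h' : ℝ} {i : Fin 5} (hh : HasDerivAt h h' (m i)) :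
    HasDirDerivAt (fun m => h (m i)) m v (h' * v i) :=
  ⟨_, hh.comp_hasFDerivAt m (hasFDerivAt_apply i m), by simp⟩

theorem add (hf : HasDirDerivAt f m v d) (hg : HasDirDerivAt g m v e) :
    HasDirDerivAt (fun m => f m + g m) m v (d + e) := by
  obtain ⟨L, hL, rfl⟩ := hf
  obtain ⟨L', hL', rfl⟩ := hg
  exact ⟨_, hL.add hL', by simp⟩

theorem sub (hf : HasDirDerivAt f m v d) (hg : HasDirDerivAt g m v e) :
    HasDirDerivAt (fun m => f m - g m) m v (d - e) := by
  obtain ⟨L, hL, rfl⟩ := hf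
  obtain ⟨L', hL', rfl⟩ := hg
  exact ⟨_, hL.sub hL', by simp⟩

theorem mul (hf : HasDirDerivAt f m v d) (hg : HasDirDerivAt g m v e) :
    HasDirDerivAt (fun m => f m * g m) m v (d * g m + f m * e) := by
  obtain ⟨L, hL, rfl⟩ := hf
  obtain ⟨L', hL', rfl⟩ := hg
  exact ⟨_, hL.mul hL', by simp; ring⟩

theorem const_mul (a : ℝ) (hf : HasDirDerivAt f m v d) :
    HasDirDerivAt (fun m => a * f m) m v (a * d) := by
  obtain ⟨L, hL, rfl⟩ := hf
  exact ⟨_, hL.const_mul a, by simp⟩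

theorem pow (hf : HasDirDerivAt f m v d) (n : ℕ) :
    HasDirDerivAt (fun m => f m ^ n) m v (n * f m ^ (n - 1) * d) := by
  obtain ⟨L, hL, rfl⟩ := hf
  exact ⟨_, (hasDerivAt_pow n (f m)).comp_hasFDerivAt m hL, by simp⟩

theorem congr (hf : HasDirDerivAt f m v d) (hg : ∀ m, f m = g m) (h : d = e) :
    HasDirDerivAt g m v e := by
  obtain rfl : f = g := funext hg
  exact h ▸ hf

end HasDirDerivAt

theorem fderiv_apply_of_hasDirDerivAt {Φ : (Fin 5 → ℝ) → Fin 5 → ℝ} {w : Fin 5 → ℝ}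
    (h : ∀ i, HasDirDerivAt (fun m => Φ m i) m v (w i)) : fderiv ℝ Φ m v = w := by
  choose L hL hw using h
  have := hasFDerivAt_pi.2 hL
  rw [this.fderiv]
  funext i
  exact hw i

end DirDeriv

/-! ### The differential equations satisfied by the coefficients -/

section Coefficients

theorem contDiffOn_succ_of_hasDerivAt {f g : ℝ → ℝ} {s : Set ℝ} (hs : IsOpen s) {n : ℕ}
    (hf : ∀ x ∈ s, HasDerivAt f (g x) x) (hg : ContDiffOn ℝ n g s) :
    ContDiffOn ℝ (n + 1 : ℕ) f s := by
  push_cast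
  rw [contDiffOn_succ_iff_deriv_of_isOpen hs]
  exact ⟨fun x hx => (hf x hx).differentiableAt.differentiableWithinAt, by simp,
    hg.congr fun x hx => (hf x hx).deriv⟩

theorem hasDerivAt_deriv_of_contDiffOn {f : ℝ → ℝ} {s : Set ℝ} (hs : IsOpen s) {n : ℕ}
    (hf : ContDiffOn ℝ (n + 1 : ℕ) f s) :
    (∀ x ∈ s, HasDerivAt f (deriv f x) x) ∧ ContDiffOn ℝ n (deriv f) s := by
  push_cast at hf
  rw [contDiffOn_succ_iff_deriv_of_isOpen hs] at hf
  exact ⟨fun x hx => (hf.1.differentiableAt (hs.mem_nhds hx)).hasDerivAt, hf.2.2⟩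

/-- The first-order system satisfied by `P`, `Q`, `R`, `A = ∫ P`, `ξ = η'/η`, `η` and
`χ = ∫ η⁻²`. -/
structure IsChazySystem (I : Set ℝ) (P Q R A ξ η χ : ℝ → ℝ) : Prop where
  isOpen : IsOpen I
  η_ne : ∀ x ∈ I, η x ≠ 0
  hP : ∀ x ∈ I, HasDerivAt P ((P x ^ 2 - Q x) / 6) x
  hQ : ∀ x ∈ I, HasDerivAt Q (2 / 3 * (P x * Q x - R x)) x
  hR : ∀ x ∈ I, HasDerivAt R (P x * R x + Q x ^ 2 / 80) x
  hA : ∀ x ∈ I, HasDerivAt A (P x) x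
  hξ : ∀ x ∈ I, HasDerivAt ξ (Q x / 40 - ξ x ^ 2) x
  hη : ∀ x ∈ I, HasDerivAt η (ξ x * η x) x
  hχ : ∀ x ∈ I, HasDerivAt χ (1 / η x ^ 2) x

/-- The equations for P and Q merely unfold the definitions of Q and R, the one for ξ is the Riccati
form of the equation for η, and the Chazy equation supplies the one for R. -/
theorem isChazySystem {I : Set ℝ} (hI : IsOpen I) {P A η χ : ℝ → ℝ}
    (hP : IsGeneralisedChazySolution (2 / 3) P I)
    (hA : ∀ x ∈ I, HasDerivAt A (P x) x) (hη : ContDiffOn ℝ 2 η I) (hη0 : ∀ x ∈ I, η x ≠ 0)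
    (hη2 : ∀ x ∈ I, deriv (deriv η) x - 1 / 40 * chazyQ P x * η x = 0)
    (hχ : ∀ x ∈ I, HasDerivAt χ (1 / η x ^ 2) x) :
    IsChazySystem I P (chazyQ P) (chazyR P) A (logDeriv η) η χ := by
  obtain ⟨hP3, hC⟩ := hP
  obtain ⟨hP0, hP3⟩ := hasDerivAt_deriv_of_contDiffOn hI (n := 2) (by exact_mod_cast hP3)
  obtain ⟨hP1, hP3⟩ := hasDerivAt_deriv_of_contDiffOn hI (n := 1) (by exact_mod_cast hP3)
  obtain ⟨hP2, -⟩ := hasDerivAt_deriv_of_contDiffOn hI (n := 0) (by exact_mod_cast hP3)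
  obtain ⟨hη1, hη3⟩ := hasDerivAt_deriv_of_contDiffOn hI (n := 1) (by exact_mod_cast hη)
  obtain ⟨hη4, -⟩ := hasDerivAt_deriv_of_contDiffOn hI (n := 0) (by exact_mod_cast hη3)
  have hQ (x) (hx : x ∈ I) :
      HasDerivAt (chazyQ P) (2 * P x * deriv P x - 6 * deriv (deriv P) x) x := by
    refine (((hP0 x hx).pow 2).sub ((hP1 x hx).const_mul 6)).congr_deriv ?_
    simp
  have hQd (x) (hx : x ∈ I) :
      deriv (chazyQ P) =ᶠ[nhds x] fun x => 2 * P x * deriv P x - 6 * deriv (deriv P) x := by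
    filter_upwards [hI.mem_nhds hx] with y hy using (hQ y hy).deriv
  have hξη (x) (hx : x ∈ I) : logDeriv η x * η x = deriv η x := by
    rw [logDeriv_apply, div_mul_cancel₀ _ (hη0 x hx)]
  refine ⟨hI, hη0, fun x hx => ?_, fun x hx => ?_, fun x hx => ?_, hA, fun x hx => ?_,
    fun x hx => ?_, hχ⟩
  · exact (hP0 x hx).congr_deriv (by rw [chazyQ]; ring)
  · exact (hQ x hx).congr_deriv (by rw [chazyR, (hQ x hx).deriv]; ring)
  · have h1 : HasDerivAt (deriv (chazyQ P)) (2 * deriv P x * deriv P x + 2 * P x * deriv (deriv P) x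
        - 6 * deriv (deriv (deriv P)) x) x := by
      refine HasDerivAt.congr_of_eventuallyEq ?_ (hQd x hx)
      exact (((hP0 x hx).const_mul 2).mul (hP1 x hx)).sub ((hP2 x hx).const_mul 6)
    refine (((hP0 x hx).mul (hQ x hx)).sub (h1.const_mul (3 / 2))).congr_deriv ?_
    rw [chazyR, (hQ x hx).deriv, chazyQ]
    -- The term -(3/2)Q'' of R' contains 9P''', and 4/(36 - k²) = 9/80 at k = 2/3.
    linear_combination 9 * hC x hx
  · refine ((hη4 x hx).div (hη1 x hx) (hη0 x hx)).congr_deriv ?_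
    have h0 := hη0 x hx
    have h2 : deriv (deriv η) x = 1 / 40 * chazyQ P x * η x := by linarith [hη2 x hx]
    rw [logDeriv_apply, h2]
    field_simp
  · rw [hξη x hx]
    exact hη1 x hx

variable {I : Set ℝ} {P Q R A ξ η χ : ℝ → ℝ}

namespace IsChazySystem

/-- Bootstrapping: the right-hand sides are polynomial in the unknowns, apart from η⁻² with η
nonvanishing, so each order of regularity yields the next. -/
theorem contDiffOn_nat (h : IsChazySystem I P Q R A ξ η χ) (n : ℕ) :
    ContDiffOn ℝ n P I ∧ ContDiffOn ℝ n Q I ∧ ContDiffOn ℝ n R I ∧ ContDiffOn ℝ n A I ∧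
      ContDiffOn ℝ n ξ I ∧ ContDiffOn ℝ n η I ∧ ContDiffOn ℝ n χ I := by
  induction n with
  | zero =>
    have hc {f f' : ℝ → ℝ} (hf : ∀ x ∈ I, HasDerivAt f (f' x) x) :
        ContDiffOn ℝ (0 : ℕ) f I := by
      rw [Nat.cast_zero, contDiffOn_zero]
      exact fun x hx => (hf x hx).continuousAt.continuousWithinAt
    exact ⟨hc h.hP, hc h.hQ, hc h.hR, hc h.hA, hc h.hξ, hc h.hη, hc h.hχ⟩
  | succ n ih =>
    obtain ⟨iP, iQ, iR, iA, iξ, iη, iχ⟩ := ih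
    refine ⟨contDiffOn_succ_of_hasDerivAt h.isOpen h.hP (by fun_prop),
      contDiffOn_succ_of_hasDerivAt h.isOpen h.hQ (by fun_prop),
      contDiffOn_succ_of_hasDerivAt h.isOpen h.hR (by fun_prop),
      contDiffOn_succ_of_hasDerivAt h.isOpen h.hA iP,
      contDiffOn_succ_of_hasDerivAt h.isOpen h.hξ (by fun_prop),
      contDiffOn_succ_of_hasDerivAt h.isOpen h.hη (by fun_prop),
      contDiffOn_succ_of_hasDerivAt h.isOpen h.hχ
        (contDiffOn_const.div (iη.pow 2) fun x hx => pow_ne_zero 2 (h.η_ne x hx))⟩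

theorem contDiffOn (h : IsChazySystem I P Q R A ξ η χ) :
    ContDiffOn ℝ ∞ P I ∧ ContDiffOn ℝ ∞ Q I ∧ ContDiffOn ℝ ∞ R I ∧ ContDiffOn ℝ ∞ A I ∧
      ContDiffOn ℝ ∞ ξ I ∧ ContDiffOn ℝ ∞ η I ∧ ContDiffOn ℝ ∞ χ I := by
  simp only [contDiffOn_infty]
  have hn := h.contDiffOn_nat
  exact ⟨fun n => (hn n).1, fun n => (hn n).2.1, fun n => (hn n).2.2.1, fun n => (hn n).2.2.2.1,
    fun n => (hn n).2.2.2.2.1, fun n => (hn n).2.2.2.2.2.1, fun n => (hn n).2.2.2.2.2.2⟩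

theorem injOn (h : IsChazySystem I P Q R A ξ η χ) (hI : I.OrdConnected) : Set.InjOn χ I := by
  refine (strictMonoOn_of_deriv_pos hI.convex
    (fun x hx => (h.hχ x hx).continuousAt.continuousWithinAt) fun x hx => ?_).injOn
  have hx' := interior_subset hx
  rw [(h.hχ x hx').deriv]
  have := h.η_ne x hx'
  positivity

end IsChazySystem
end Coefficients

/-! ### The flattening in terms of five simpler functions -/

section Coordinates

/-- The function `T = p/η - (6ξ + P) e^{-½∫P} y / (2η)`. -/
noncomputable def coordT (P A η : ℝ → ℝ) (m : Fin 5 → ℝ) : ℝ :=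
  (η (m 0))⁻¹ * m 3 -
    1 / 2 * (η (m 0))⁻¹ * (6 * logDeriv η (m 0) + P (m 0)) * Real.exp (-(A (m 0) / 2)) * m 1

/-- The function `Y = e^{-½∫P} y / η³`. -/
noncomputable def coordY (A η : ℝ → ℝ) (m : Fin 5 → ℝ) : ℝ :=
  (η (m 0))⁻¹ ^ 3 * Real.exp (-(A (m 0) / 2)) * m 1

/-- The function `K = c₂ - 6 χ J² + 16 T J`. -/
noncomputable def coordK (P A η : ℝ → ℝ) (m : Fin 5 → ℝ) : ℝ :=
  let x := m 0; let y := m 1; let z := m 2; let p := m 3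
  let a := 6 * logDeriv η x + P x; let ε := Real.exp (-(A x / 2))
  6 * z - 4 * a * p ^ 2 + 2 * a ^ 2 * ε * y * p - 1 / 3 * a ^ 3 * ε ^ 2 * y ^ 2
    + P x * p ^ 2 + chazyQ P x / 10 * ε * y * p + chazyR P x / 30 * ε ^ 2 * y ^ 2

variable {P A η χ : ℝ → ℝ}

/-- Together with `exp_eq_sq` this leaves a single exponential in later identities, which become
rational. -/
theorem exp_neg_eq (a : ℝ) : Real.exp (-a) = Real.exp (-(a / 2)) ^ 2 := by
  rw [← Real.exp_nat_mul]; congr 1; push_cast; ring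

theorem exp_eq_sq (a : ℝ) : Real.exp a = Real.exp (a / 2) ^ 2 := by
  rw [← Real.exp_nat_mul]; congr 1; push_cast; ring

/-- This separates a fixed polynomial map from the functions χ, J, T, Y, K, on which the fields act
simply. -/
theorem flattening_eq (m : Fin 5 → ℝ) : flattening P A η χ m =
    ![1 / 8 * J P A η m * χ (m 0) ^ 2 - 1 / 8 * coordT P A η m * χ (m 0) - 3 / 8 * coordY A η m,
      6 * χ (m 0) * J P A η m ^ 2 - 16 * coordT P A η m * J P A η m + coordK P A η m,
      coordT P A η m - 1 / 2 * J P A η m * χ (m 0), -(1 / 8) * χ (m 0), 4 * J P A η m] := by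
  funext i
  fin_cases i
  · simp only [flattening, c1, coordT, coordY, Fin.zero_eta, Matrix.cons_val_zero]
    ring
  · simp only [flattening, c2, coordT, coordK, Fin.mk_one, Matrix.cons_val_one,
      Matrix.cons_val_zero, exp_neg_eq (A (m 0))]
    ring
  · simp only [flattening, c3, coordT, Fin.reduceFinMk, Matrix.cons_val]
    ring
  · rfl
  · rfl

theorem hasDerivAt_exp_neg_half {x a : ℝ} (hA : HasDerivAt A a x) :
    HasDerivAt (fun x => Real.exp (-(A x / 2))) (-(a / 2) * Real.exp (-(A x / 2))) x :=
  (((hA.div_const 2).fun_neg).exp).congr_deriv (by ring)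

theorem hasDerivAt_exp_half {x a : ℝ} (hA : HasDerivAt A a x) :
    HasDerivAt (fun x => Real.exp (A x / 2)) (a / 2 * Real.exp (A x / 2)) x :=
  ((hA.div_const 2).exp).congr_deriv (by ring)

variable {I : Set ℝ} {m v : Fin 5 → ℝ}

theorem hasDerivAt_inv_scale (h : IsChazySystem I P (chazyQ P) (chazyR P) A (logDeriv η) η χ)
    {x : ℝ} (hx : x ∈ I) :
    HasDerivAt (fun x => (η x)⁻¹) (-logDeriv η x * (η x)⁻¹) x := by
  have h0 := h.η_ne x hx
  refine ((h.hη x hx).inv h0).congr_deriv ?_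
  field_simp

/-- The direction `v` is left arbitrary here and in the next three lemmas: they serve both for the
images of the fields and for the invertibility of the differential. -/
theorem hasDirDerivAt_coordY (h : IsChazySystem I P (chazyQ P) (chazyR P) A (logDeriv η) η χ)
    (hm : m 0 ∈ I) : HasDirDerivAt (coordY A η) m v
      ((η (m 0))⁻¹ ^ 3 * Real.exp (-(A (m 0) / 2)) *
        (v 1 - (3 * logDeriv η (m 0) + P (m 0) / 2) * m 1 * v 0)) := by
  have hN := HasDirDerivAt.comp_coord (v := v) (hasDerivAt_inv_scale h hm)
  have hE := HasDirDerivAt.comp_coord (v := v) (hasDerivAt_exp_neg_half (h.hA _ hm))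
  exact (((hN.pow 3).mul hE).mul (.coord 1)).congr (fun m => by rw [coordY]) (by push_cast; ring)

theorem hasDirDerivAt_coordT (h : IsChazySystem I P (chazyQ P) (chazyR P) A (logDeriv η) η χ)
    (hm : m 0 ∈ I) : HasDirDerivAt (coordT P A η) m v
    (let x := m 0; let y := m 1; let p := m 3
     let a := 6 * logDeriv η x + P x; let ξ := logDeriv η x
     let a' := 6 * (chazyQ P x / 40 - ξ ^ 2) + (P x ^ 2 - chazyQ P x) / 6
     let ε := Real.exp (-(A x / 2)); let n := (η x)⁻¹
     n * (v 3 - 1 / 2 * a * ε * v 1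
       + (-ξ * p - 1 / 2 * ε * y * (-ξ * a + a' - 1 / 2 * P x * a)) * v 0)) := by
  have hN := HasDirDerivAt.comp_coord (v := v) (hasDerivAt_inv_scale h hm)
  have hE := HasDirDerivAt.comp_coord (v := v) (hasDerivAt_exp_neg_half (h.hA _ hm))
  have ha := ((HasDirDerivAt.comp_coord (v := v) (h.hξ _ hm)).const_mul 6).add
    (.comp_coord (h.hP _ hm))
  exact ((hN.mul (.coord 3)).sub
    ((((hN.const_mul (1 / 2)).mul ha).mul hE).mul (.coord 1))).congr
      (fun m => by rw [coordT]) (by ring)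

theorem hasDirDerivAt_J (h : IsChazySystem I P (chazyQ P) (chazyR P) A (logDeriv η) η χ)
    (hm : m 0 ∈ I) : HasDirDerivAt (J P A η) m v
    (let x := m 0; let y := m 1; let p := m 3; let q := m 4
     let ξ := logDeriv η x; let a := 6 * ξ + P x; let Q := chazyQ P x
     let ξ' := Q / 40 - ξ ^ 2; let P' := (P x ^ 2 - Q) / 6
     let ε := Real.exp (-(A x / 2)); let n := η x
     n * (1 / 6 * ε * (a ^ 2 + Q / 20) * v 1 - 1 / 2 * (8 * ξ + P x) * v 3
       + Real.exp (A x / 2) * v 4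
       + (1 / 6 * ε * y * ((ξ - P x / 2) * (a ^ 2 + Q / 20) + 2 * a * (6 * ξ' + P')
            + (P x * Q - chazyR P x) / 30)
          - 1 / 2 * p * (ξ * (8 * ξ + P x) + 8 * ξ' + P')
          + Real.exp (A x / 2) * q * (ξ + P x / 2)) * v 0)) := by
  have hn := HasDirDerivAt.comp_coord (v := v) (h.hη _ hm)
  have hε := HasDirDerivAt.comp_coord (v := v) (hasDerivAt_exp_neg_half (h.hA _ hm))
  have hE := HasDirDerivAt.comp_coord (v := v) (hasDerivAt_exp_half (h.hA _ hm))
  have hξ := HasDirDerivAt.comp_coord (v := v) (h.hξ _ hm)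
  have hP := HasDirDerivAt.comp_coord (v := v) (h.hP _ hm)
  have hQ := HasDirDerivAt.comp_coord (v := v) (h.hQ _ hm)
  have hb := (((hξ.const_mul 6).add hP).pow 2).add (hQ.const_mul (1 / 20))
  exact (((((hn.const_mul (1 / 6)).mul hε).mul hb).mul (.coord 1)).sub
    (((hn.const_mul (1 / 2)).mul ((hξ.const_mul 8).add hP)).mul (.coord 3))).add
      ((hn.mul hE).mul (.coord 4)) |>.congr (fun m => by rw [J]; ring) (by push_cast; ring)

/-- Of the four functions only K involves R, so R' appears here alone, multiplied by `v 0`. -/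
theorem hasDirDerivAt_coordK (h : IsChazySystem I P (chazyQ P) (chazyR P) A (logDeriv η) η χ)
    (hm : m 0 ∈ I) : HasDirDerivAt (coordK P A η) m v
    (let x := m 0; let y := m 1; let p := m 3
     let ξ := logDeriv η x; let a := 6 * ξ + P x; let Q := chazyQ P x; let R := chazyR P x
     let P' := (P x ^ 2 - Q) / 6; let a' := 6 * (Q / 40 - ξ ^ 2) + P'
     let ε := Real.exp (-(A x / 2))
     6 * v 2 + (-8 * a * p + 2 * a ^ 2 * ε * y + 2 * P x * p + Q / 10 * ε * y) * v 3
       + (2 * a ^ 2 * ε * p - 2 / 3 * a ^ 3 * ε ^ 2 * y + Q / 10 * ε * p + R / 15 * ε ^ 2 * y) * v 1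
       + ((-4 * a' + P') * p ^ 2
          + (4 * a * a' - P x * a ^ 2 + (P x * Q - R) / 15 - P x * Q / 20) * ε * y * p
          + (-a ^ 2 * a' + 1 / 3 * P x * a ^ 3 + (P x * R + Q ^ 2 / 80) / 30 - P x * R / 30)
            * ε ^ 2 * y ^ 2) * v 0) := by
  have hε := HasDirDerivAt.comp_coord (v := v) (hasDerivAt_exp_neg_half (h.hA _ hm))
  have hξ := HasDirDerivAt.comp_coord (v := v) (h.hξ _ hm)
  have hP := HasDirDerivAt.comp_coord (v := v) (h.hP _ hm)
  have hQ := HasDirDerivAt.comp_coord (v := v) (h.hQ _ hm)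
  have hR := HasDirDerivAt.comp_coord (v := v) (h.hR _ hm)
  have ha := (hξ.const_mul 6).add hP
  have hp : HasDirDerivAt (fun m => m 3) m v (v 3) := .coord 3
  have hεy := hε.mul (.coord 1)
  exact (((HasDirDerivAt.coord 2).const_mul 6).sub ((ha.const_mul 4).mul (hp.pow 2))).add
    ((((ha.pow 2).const_mul 2).mul hεy).mul hp) |>.sub
    (((ha.pow 3).const_mul (1 / 3)).mul (hεy.pow 2)) |>.add (hP.mul (hp.pow 2)) |>.add
    (((hQ.const_mul (1 / 10)).mul hεy).mul hp) |>.add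
    ((hR.const_mul (1 / 30)).mul (hεy.pow 2)) |>.congr
    (fun m => by rw [coordK]; ring) (by push_cast; ring)

/-- The differential of the flattening, in terms of those of `χ`, `J`, `T`, `Y` and `K`. -/
theorem fderiv_flattening {dJ dT dY dK dχ : ℝ} (hJ : HasDirDerivAt (J P A η) m v dJ)
    (hT : HasDirDerivAt (coordT P A η) m v dT) (hY : HasDirDerivAt (coordY A η) m v dY)
    (hK : HasDirDerivAt (coordK P A η) m v dK) (hχ : HasDirDerivAt (fun m => χ (m 0)) m v dχ) :
    fderiv ℝ (flattening P A η χ) m v =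
      ![1 / 8 * χ (m 0) ^ 2 * dJ + 1 / 4 * J P A η m * χ (m 0) * dχ - 1 / 8 * χ (m 0) * dT
          - 1 / 8 * coordT P A η m * dχ - 3 / 8 * dY,
        6 * J P A η m ^ 2 * dχ + 12 * χ (m 0) * J P A η m * dJ - 16 * coordT P A η m * dJ
          - 16 * J P A η m * dT + dK,
        dT - 1 / 2 * J P A η m * dχ - 1 / 2 * χ (m 0) * dJ, -(1 / 8) * dχ, 4 * dJ] := by
  apply fderiv_apply_of_hasDirDerivAt
  intro i
  simp only [flattening_eq]
  fin_cases i
  · exact (((hJ.const_mul (1 / 8)).mul (hχ.pow 2)).sub ((hT.const_mul (1 / 8)).mul hχ)).sub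
      (hY.const_mul (3 / 8)) |>.congr (fun m => rfl) (by simp; ring)
  · exact (((hχ.const_mul 6).mul (hJ.pow 2)).sub ((hT.const_mul 16).mul hJ)).add hK |>.congr
      (fun m => rfl) (by simp; ring)
  · exact hT.sub ((hJ.const_mul (1 / 2)).mul hχ) |>.congr (fun m => rfl) (by simp; ring)
  · exact hχ.const_mul (-(1 / 8)) |>.congr (fun m => rfl) (by simp)
  · exact hJ.const_mul 4 |>.congr (fun m => rfl) (by simp)

end Coordinates

/-! ### The images of the three fields under the flattening -/

section Images

variable {P A η χ : ℝ → ℝ} {I : Set ℝ} {m : Fin 5 → ℝ}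

theorem S1_eq (m : Fin 5 → ℝ) : S1 P A η m =
    ![-(8 * η (m 0) ^ 2), -(8 * η (m 0) ^ 2) * (Real.exp (A (m 0) / 2) * m 3),
      -(8 * η (m 0) ^ 2) * (Real.exp (A (m 0) / 2) ^ 2 * m 4 ^ 2),
      -(8 * η (m 0) ^ 2) * (Real.exp (A (m 0) / 2) * m 4), -s1Coeff P A η m] := by
  funext i
  fin_cases i <;> simp [S1, X1, X2, partialVec, exp_eq_sq (A (m 0))]

theorem S2_eq (m : Fin 5 → ℝ) : S2 A η m =
    ![0, 0, 0, 0, Real.exp (-(A (m 0) / 2)) / (4 * η (m 0))] := by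
  funext i
  fin_cases i <;> simp [S2, X1, partialVec]

/-- The field `X³ - β X¹` mapped by the flattening to `Z¹`. -/
noncomputable def liftZ1 (P A η χ : ℝ → ℝ) (m : Fin 5 → ℝ) : Fin 5 → ℝ :=
  let x := m 0; let P₀ := P x; let Q := chazyQ P x; let ξ := logDeriv η x
  X3 P A η χ m - (η x * Real.exp (-(A x / 2)) *
      ((6 * ξ ^ 2 + 3 / 2 * P₀ * ξ + 1 / 12 * (P₀ ^ 2 - Q / 10)) * η x ^ 2 * χ x
        - 4 * ξ - 1 / 2 * P₀)) • X1 m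

theorem liftZ1_eq (m : Fin 5 → ℝ) : liftZ1 P A η χ m =
    (let x := m 0; let y := m 1; let p := m 3; let q := m 4
     let P₀ := P x; let Q := chazyQ P x; let R := chazyR P x; let ξ := logDeriv η x
     ![0, -(η x ^ 3 * χ x * Real.exp (A x / 2)),
      η x ^ 3 * χ x *
        (Real.exp (-(A x / 2)) *
            (12 * ξ ^ 3 + 6 * P₀ * ξ ^ 2 + (P₀ ^ 2 + Q / 20) * ξ + P₀ ^ 3 / 18 + P₀ * Q / 120
              + R / 90) * y
          - (12 * ξ ^ 2 + 3 * P₀ * ξ + P₀ ^ 2 / 6 - Q / 60) * p)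
        + η x * (1 / 3 * ((6 * ξ + P₀) ^ 2 + Q / 20) * Real.exp (-(A x / 2)) * y
          - (8 * ξ + P₀) * p + 4 * Real.exp (A x / 2) * q),
      η x - η x ^ 3 * χ x / 2 * (6 * ξ + P₀),
      -(η x * Real.exp (-(A x / 2)) *
      ((6 * ξ ^ 2 + 3 / 2 * P₀ * ξ + 1 / 12 * (P₀ ^ 2 - Q / 10)) * η x ^ 2 * χ x
        - 4 * ξ - 1 / 2 * P₀))]) := by
  funext i
  fin_cases i <;> simp [liftZ1, X3, X1, partialVec]

/-- The coefficient of `X2` in `S3` is 8η²c₁, and `ell3` collects the `X1` terms of the three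
summands. The combination is that of `flatS3_eq`. -/
theorem S3_eq (h0 : η (m 0) ≠ 0) : S3 P A η χ m =
    -c1 P A η χ m • S1 P A η m + c2 P A η χ m • S2 A η m
      - c3 P A η χ m ^ 2 • liftZ1 P A η χ m := by
  have hμ : (1 / 6 * ((6 * logDeriv η (m 0) + P (m 0)) ^ 2 + chazyQ P (m 0) / 20) *
        Real.exp (-(A (m 0) / 2)) * m 1 - 1 / 2 * (8 * logDeriv η (m 0) + P (m 0)) * m 3
          + Real.exp (A (m 0) / 2) * m 4) * η (m 0) ^ 3 * χ (m 0) ^ 2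
        + (1 / 2 * (6 * logDeriv η (m 0) + P (m 0)) * Real.exp (-(A (m 0) / 2)) * m 1 - m 3) *
          η (m 0) * χ (m 0) - 3 / η (m 0) * Real.exp (-(A (m 0) / 2)) * m 1 =
      8 * η (m 0) ^ 2 * c1 P A η χ m := by
    rw [c1, J]
    field_simp
    ring
  rw [S3]
  simp only [hμ]
  rw [S1, S2, liftZ1, ell3]
  module

theorem flatS3_eq (c : Fin 5 → ℝ) :
    flatS3 c = -c 0 • flatS1 c + c 1 • flatS2 c - c 2 ^ 2 • flatZ1 c := by
  rw [flatS3, flatS1, flatS2]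
  module

/-- The coefficient of `X1` makes J constant along `S1`; up to the factor -8 the field is ∂_χ + T∂_Y
+ J∂_T + 6J²∂_K. The identity `dK` is the one that depends on the formula for R', since the other
two fields have no x-component. -/
theorem fderiv_flattening_S1
    (h : IsChazySystem I P (chazyQ P) (chazyR P) A (logDeriv η) η χ) (hm : m 0 ∈ I) :
    fderiv ℝ (flattening P A η χ) m (S1 P A η m) = flatS1 (flattening P A η χ m) := by
  have h0 := h.η_ne _ hm
  have hE : Real.exp (A (m 0) / 2) ≠ 0 := Real.exp_ne_zero _
  have dJ : HasDirDerivAt (J P A η) m (S1 P A η m) 0 := by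
    refine (hasDirDerivAt_J h hm).congr (fun _ => rfl) ?_
    simp only [S1_eq, s1Coeff, exp_neg_eq (A (m 0)), Real.exp_neg, Matrix.cons_val]
    field_simp
    ring
  have dT : HasDirDerivAt (coordT P A η) m (S1 P A η m) (-8 * J P A η m) := by
    refine (hasDirDerivAt_coordT h hm).congr (fun _ => rfl) ?_
    simp only [S1_eq, s1Coeff, J, exp_neg_eq (A (m 0)), Real.exp_neg, Matrix.cons_val]
    field_simp
    ring
  have dY : HasDirDerivAt (coordY A η) m (S1 P A η m) (-8 * coordT P A η m) := by
    refine (hasDirDerivAt_coordY h hm).congr (fun _ => rfl) ?_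
    simp only [S1_eq, coordT, Real.exp_neg, Matrix.cons_val]
    field_simp
    ring
  have dK : HasDirDerivAt (coordK P A η) m (S1 P A η m) (-48 * J P A η m ^ 2) := by
    refine (hasDirDerivAt_coordK h hm).congr (fun _ => rfl) ?_
    simp only [S1_eq, s1Coeff, J, exp_neg_eq (A (m 0)), Real.exp_neg, Matrix.cons_val]
    field_simp
    ring
  have dχ : HasDirDerivAt (fun m => χ (m 0)) m (S1 P A η m) (-8) := by
    refine (HasDirDerivAt.comp_coord (h.hχ _ hm)).congr (fun _ => rfl) ?_
    simp only [S1_eq, Matrix.cons_val]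
    field_simp
  rw [fderiv_flattening dJ dT dY dK dχ, flattening_eq]
  funext i
  fin_cases i <;> simp [flatS1, flatZ1, flatZ2, partialVec] <;> ring

/-- In the coordinates χ, Y, K, T, J this field is ¼∂_J, as q occurs only in J. -/
theorem fderiv_flattening_S2
    (h : IsChazySystem I P (chazyQ P) (chazyR P) A (logDeriv η) η χ) (hm : m 0 ∈ I) :
    fderiv ℝ (flattening P A η χ) m (S2 A η m) = flatS2 (flattening P A η χ m) := by
  have h0 := h.η_ne _ hm
  have hE : Real.exp (A (m 0) / 2) ≠ 0 := Real.exp_ne_zero _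
  have dJ : HasDirDerivAt (J P A η) m (S2 A η m) (1 / 4) := by
    refine (hasDirDerivAt_J h hm).congr (fun _ => rfl) ?_
    simp only [S2_eq, Real.exp_neg, Matrix.cons_val]
    field_simp
    ring
  have dT : HasDirDerivAt (coordT P A η) m (S2 A η m) 0 := by
    refine (hasDirDerivAt_coordT h hm).congr (fun _ => rfl) ?_
    simp [S2_eq]
  have dY : HasDirDerivAt (coordY A η) m (S2 A η m) 0 := by
    refine (hasDirDerivAt_coordY h hm).congr (fun _ => rfl) ?_
    simp [S2_eq]
  have dK : HasDirDerivAt (coordK P A η) m (S2 A η m) 0 := by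
    refine (hasDirDerivAt_coordK h hm).congr (fun _ => rfl) ?_
    simp [S2_eq]
  have dχ : HasDirDerivAt (fun m => χ (m 0)) m (S2 A η m) 0 := by
    refine (HasDirDerivAt.comp_coord (h.hχ _ hm)).congr (fun _ => rfl) ?_
    simp [S2_eq]
  rw [fderiv_flattening dJ dT dY dK dχ, flattening_eq]
  funext i
  fin_cases i <;> simp [flatS2, flatZ1, flatZ3, partialVec] <;> ring

/-- In the coordinates χ, Y, K, T, J this field is ∂_T - χ∂_Y + 24J∂_K; subtracting the multiple of
`X1` from `X3` removes the J-component. -/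
theorem fderiv_flattening_liftZ1
    (h : IsChazySystem I P (chazyQ P) (chazyR P) A (logDeriv η) η χ) (hm : m 0 ∈ I) :
    fderiv ℝ (flattening P A η χ) m (liftZ1 P A η χ m) = flatZ1 (flattening P A η χ m) := by
  have h0 := h.η_ne _ hm
  have hE : Real.exp (A (m 0) / 2) ≠ 0 := Real.exp_ne_zero _
  have dJ : HasDirDerivAt (J P A η) m (liftZ1 P A η χ m) 0 := by
    refine (hasDirDerivAt_J h hm).congr (fun _ => rfl) ?_
    simp only [liftZ1_eq, Real.exp_neg, Matrix.cons_val]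
    field_simp
    ring
  have dT : HasDirDerivAt (coordT P A η) m (liftZ1 P A η χ m) 1 := by
    refine (hasDirDerivAt_coordT h hm).congr (fun _ => rfl) ?_
    simp only [liftZ1_eq, Real.exp_neg, Matrix.cons_val]
    field_simp
    ring
  have dY : HasDirDerivAt (coordY A η) m (liftZ1 P A η χ m) (-χ (m 0)) := by
    refine (hasDirDerivAt_coordY h hm).congr (fun _ => rfl) ?_
    simp only [liftZ1_eq, Real.exp_neg, Matrix.cons_val]
    field_simp
    ring
  have dK : HasDirDerivAt (coordK P A η) m (liftZ1 P A η χ m) (24 * J P A η m) := by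
    refine (hasDirDerivAt_coordK h hm).congr (fun _ => rfl) ?_
    simp only [liftZ1_eq, J, Real.exp_neg, Matrix.cons_val]
    field_simp
    ring
  have dχ : HasDirDerivAt (fun m => χ (m 0)) m (liftZ1 P A η χ m) 0 := by
    refine (HasDirDerivAt.comp_coord (h.hχ _ hm)).congr (fun _ => rfl) ?_
    simp [liftZ1_eq]
  rw [fderiv_flattening dJ dT dY dK dχ, flattening_eq]
  funext i
  fin_cases i <;> simp [flatZ1, partialVec] <;> ring

theorem fderiv_flattening_S3
    (h : IsChazySystem I P (chazyQ P) (chazyR P) A (logDeriv η) η χ) (hm : m 0 ∈ I) :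
    fderiv ℝ (flattening P A η χ) m (S3 P A η χ m) = flatS3 (flattening P A η χ m) := by
  rw [S3_eq (h.η_ne _ hm), map_sub, map_add, map_smul, map_smul, map_smul,
    fderiv_flattening_S1 h hm, fderiv_flattening_S2 h hm, fderiv_flattening_liftZ1 h hm, flatS3_eq]
  rfl

end Images

/-! ### The flattening is a change of coordinates -/

section ChangeOfCoordinates

variable {P A η χ : ℝ → ℝ} {I : Set ℝ} {m : Fin 5 → ℝ}

theorem fderiv_flattening_isInvertible
    (h : IsChazySystem I P (chazyQ P) (chazyR P) A (logDeriv η) η χ) (hm : m 0 ∈ I) :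
    (fderiv ℝ (flattening P A η χ) m).IsInvertible := by
  have h0 := h.η_ne _ hm
  -- In equal finite dimensions injectivity suffices. The components are solved triangularly: dχ
  -- gives `v 0`, then dJ and dT vanish, dY gives `v 1`, dT gives `v 3`, dK gives `v 2` and dJ gives
  -- `v 4`.
  have hinj : Function.Injective (fderiv ℝ (flattening P A η χ) m) := by
    rw [injective_iff_map_eq_zero]
    intro v hv
    rw [fderiv_flattening (hasDirDerivAt_J h hm) (hasDirDerivAt_coordT h hm)
      (hasDirDerivAt_coordY h hm) (hasDirDerivAt_coordK h hm)
      (.comp_coord (h.hχ _ hm))] at hv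
    have e0 := congrFun hv 0
    have e1 := congrFun hv 1
    have e2 := congrFun hv 2
    have e3 := congrFun hv 3
    have e4 := congrFun hv 4
    simp only [Matrix.cons_val, Pi.zero_apply] at e0 e1 e2 e3 e4
    have v0 : v 0 = 0 := by simpa [h0] using e3
    simp only [v0, mul_zero, add_zero, sub_zero] at e0 e1 e2 e4
    have dJ := (mul_eq_zero.1 e4).resolve_left (by norm_num)
    simp only [dJ, mul_zero, add_zero, zero_sub, sub_zero] at e0 e1 e2
    simp only [e2, mul_zero] at e0 e1
    have v1 : v 1 = 0 := by simpa [h0] using e0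
    have v3 : v 3 = 0 := by simpa [h0, v1] using e2
    have v2 : v 2 = 0 := by simpa [v1, v3] using e1
    have v4 : v 4 = 0 := by simpa [h0, v1, v3] using dJ
    funext i
    fin_cases i <;> assumption
  exact ⟨(LinearEquiv.ofInjectiveEndo (fderiv ℝ (flattening P A η χ) m : (Fin 5 → ℝ) →ₗ[ℝ] _)
    hinj).toContinuousLinearEquiv, by ext v; rfl⟩

/-- The triangular elimination holds for values as well as for differentials; its first step is the
strict monotonicity of χ on an interval. -/
theorem injOn_flattening (U : TopologicalSpace.Opens ℝ) (hU : (U : Set ℝ).OrdConnected)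
    (h : IsChazySystem U P (chazyQ P) (chazyR P) A (logDeriv η) η χ) :
    Set.InjOn (flattening P A η χ) (domain U) := by
  intro m hm m' hm' he
  have hm : m 0 ∈ U := hm
  have hm' : m' 0 ∈ U := hm'
  rw [flattening_eq, flattening_eq] at he
  have e0 := congrFun he 0
  have e1 := congrFun he 1
  have e2 := congrFun he 2
  have e3 := congrFun he 3
  have e4 := congrFun he 4
  simp only [Matrix.cons_val] at e0 e1 e2 e3 e4
  have eχ : χ (m 0) = χ (m' 0) := by linarith
  have v0 : m 0 = m' 0 := h.injOn hU hm hm' eχ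
  have eJ : J P A η m = J P A η m' := by linarith
  have eT : coordT P A η m = coordT P A η m' := by rw [eJ, eχ] at e2; linarith
  have eY : coordY A η m = coordY A η m' := by rw [eJ, eχ, eT] at e0; linarith
  have eK : coordK P A η m = coordK P A η m' := by rw [eJ, eχ, eT] at e1; linarith
  have h0 := h.η_ne _ hm'
  have v1 : m 1 = m' 1 := by simpa [coordY, v0, h0] using eY
  have v3 : m 3 = m' 3 := by simpa [coordT, v0, v1, h0] using eT
  have v4 : m 4 = m' 4 := by simpa [J, v0, v1, v3, h0] using eJ
  have v2 : m 2 = m' 2 := by simpa [coordK, v0, v1, v3] using eK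
  funext i
  fin_cases i <;> assumption

theorem contDiffOn_flattening (U : TopologicalSpace.Opens ℝ)
    (h : IsChazySystem U P (chazyQ P) (chazyR P) A (logDeriv η) η χ) :
    ContDiffOn ℝ ∞ (flattening P A η χ) (domain U) := by
  obtain ⟨hP, hQ, hR, hA, hξ, hη, hχ⟩ := h.contDiffOn
  have hc {f : ℝ → ℝ} (hf : ContDiffOn ℝ ∞ f U) :
      ContDiffOn ℝ ∞ (fun m : Fin 5 → ℝ => f (m 0)) (domain U) :=
    hf.comp (contDiff_apply ℝ ℝ 0).contDiffOn fun m hm => hm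
  have hP := hc hP
  have hQ := hc hQ
  have hR := hc hR
  have hξ := hc hξ
  have hN := hc (hη.inv h.η_ne)
  have hE := hc (hA.div_const 2).exp
  have hε := hc (hA.div_const 2).neg.exp
  have hη := hc hη
  have hχ := hc hχ
  have hi (i : Fin 5) : ContDiffOn ℝ ∞ (fun m : Fin 5 → ℝ => m i) (domain U) :=
    (contDiff_apply ℝ ℝ i).contDiffOn
  have hk (k : ℝ) : ContDiffOn ℝ ∞ (fun _ : Fin 5 → ℝ => k) (domain U) := contDiffOn_const
  have ha := ((hk 6).mul hξ).add hP
  have hJ : ContDiffOn ℝ ∞ (J P A η) (domain U) :=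
    (((((hη.div_const 6).mul hε).mul ((ha.pow 2).add (hQ.div_const 20))).mul (hi 1)).sub
      (((hη.div_const 2).mul (((hk 8).mul hξ).add hP)).mul (hi 3))).add ((hη.mul hE).mul (hi 4))
  have hT : ContDiffOn ℝ ∞ (coordT P A η) (domain U) :=
    (hN.mul (hi 3)).sub (((((hk (1 / 2)).mul hN).mul ha).mul hε).mul (hi 1))
  have hY : ContDiffOn ℝ ∞ (coordY A η) (domain U) := ((hN.pow 3).mul hε).mul (hi 1)
  have hK : ContDiffOn ℝ ∞ (coordK P A η) (domain U) :=
    ((((((hk 6).mul (hi 2)).sub (((hk 4).mul ha).mul ((hi 3).pow 2))).add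
      (((((hk 2).mul (ha.pow 2)).mul hε).mul (hi 1)).mul (hi 3))).sub
      ((((hk (1 / 3)).mul (ha.pow 3)).mul (hε.pow 2)).mul ((hi 1).pow 2))).add
      (hP.mul ((hi 3).pow 2))).add ((((hQ.div_const 10).mul hε).mul (hi 1)).mul (hi 3)) |>.add
      (((hR.div_const 30).mul (hε.pow 2)).mul ((hi 1).pow 2))
  rw [contDiffOn_pi]
  intro i
  simp only [flattening_eq]
  fin_cases i
  · exact (((((hk (1 / 8)).mul hJ).mul (hχ.pow 2)).sub (((hk (1 / 8)).mul hT).mul hχ)).sub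
      ((hk (3 / 8)).mul hY))
  · exact ((((hk 6).mul hχ).mul (hJ.pow 2)).sub (((hk 16).mul hT).mul hJ)).add hK
  · exact hT.sub (((hk (1 / 2)).mul hJ).mul hχ)
  · exact (hk (-(1 / 8))).mul hχ
  · exact (hk 4).mul hJ

end ChangeOfCoordinates

/-! ### The distributions -/

section Distributions

variable {P A F η χ : ℝ → ℝ} {I : Set ℝ} {m : Fin 5 → ℝ}

theorem span_X1_X2 (hF : deriv (deriv F) (m 0) = Real.exp (A (m 0) / 2)) :
    Submodule.span ℝ {X1 m, X2 A m} = chazyDistribution F m := by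
  ext v
  simp only [Submodule.mem_span_pair, chazyDistribution, Submodule.mem_inf, LinearMap.mem_ker,
    LinearMap.sub_apply, LinearMap.smul_apply, dCoord, LinearMap.proj_apply, smul_eq_mul, hF]
  constructor
  · rintro ⟨a, b, rfl⟩
    simp [X1, X2, partialVec, exp_eq_sq (A (m 0))]
    refine ⟨⟨?_, ?_⟩, ?_⟩ <;> ring
  · rintro ⟨⟨h1, h3⟩, h2⟩
    refine ⟨v 4, v 0, ?_⟩
    funext i
    fin_cases i <;> simp [X1, X2, partialVec, exp_eq_sq (A (m 0))] <;> linarith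

theorem span_flatS1_flatS2 (c : Fin 5 → ℝ) :
    Submodule.span ℝ {flatS1 c, flatS2 c} = flatCartan c := by
  ext v
  simp only [Submodule.mem_span_pair, flatCartan, Submodule.mem_inf, LinearMap.mem_ker,
    LinearMap.sub_apply, LinearMap.add_apply, LinearMap.smul_apply, dCoord, LinearMap.proj_apply,
    smul_eq_mul]
  constructor
  · rintro ⟨a, b, rfl⟩
    simp [flatS1, flatS2, flatZ1, flatZ2, flatZ3, partialVec]
    refine ⟨⟨?_, ?_⟩, ?_⟩ <;> ring
  · rintro ⟨⟨h1, h3⟩, h2⟩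
    -- The (c₄, c₅)-components of the two flat fields are (1, 0) and (0, 1), so the coefficients can
    -- be read off.
    refine ⟨v 3, v 4, ?_⟩
    funext i
    fin_cases i <;> simp [flatS1, flatS2, flatZ1, flatZ2, flatZ3, partialVec]
    · linear_combination -h1 - 2 * c 3 * h2
    · linear_combination -h3 + 2 * c 4 * h2
    · linear_combination -h2

/-- The change of frame is triangular, with nowhere vanishing diagonal entries -8η² and
e^{-½∫P}/(4η). -/
theorem span_S1_S2 (h0 : η (m 0) ≠ 0) :
    Submodule.span ℝ {S1 P A η m, S2 A η m} = Submodule.span ℝ {X1 m, X2 A m} := by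
  have hX1 : X1 m = (4 * η (m 0) * Real.exp (A (m 0) / 2)) • S2 A η m := by
    rw [S2, smul_smul, Real.exp_neg]
    have hE : Real.exp (A (m 0) / 2) ≠ 0 := Real.exp_ne_zero _
    rw [show 4 * η (m 0) * Real.exp (A (m 0) / 2) *
      ((Real.exp (A (m 0) / 2))⁻¹ / (4 * η (m 0))) = 1 by field_simp, one_smul]
  apply le_antisymm <;> rw [Submodule.span_le] <;> rintro _ (rfl | rfl)
  · exact Submodule.mem_span_pair.2 ⟨-s1Coeff P A η m, -(8 * η (m 0) ^ 2), by rw [S1]; module⟩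
  · exact Submodule.mem_span_pair.2 ⟨Real.exp (-(A (m 0) / 2)) / (4 * η (m 0)), 0, by
      rw [S2]; module⟩
  · exact Submodule.mem_span_pair.2 ⟨0, _, by rw [zero_smul, zero_add]; exact hX1.symm⟩
  · refine Submodule.mem_span_pair.2 ⟨-(8 * η (m 0) ^ 2)⁻¹, -(8 * η (m 0) ^ 2)⁻¹ * s1Coeff P A η m *
      (4 * η (m 0) * Real.exp (A (m 0) / 2)), ?_⟩
    rw [mul_smul, ← hX1, S1, smul_sub, smul_smul, smul_smul,
      show -(8 * η (m 0) ^ 2)⁻¹ * (8 * η (m 0) ^ 2) = -1 by field_simp]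
    module

end Distributions

end GenChazy

/-! ### The generalised Chazy distribution with parameter 2/3: flatness and split 𝔤₂ symmetry. -/

theorem theorem6p1
    (I : TopologicalSpace.Opens ℝ) (hI : (I : Set ℝ).OrdConnected) (hne : (I : Set ℝ).Nonempty)
    (P A F η χ : ℝ → ℝ)
    -- `P` solves the generalised Chazy equation with parameter `2/3`
    (hP : GenChazy.IsGeneralisedChazySolution (2 / 3) P I)
    -- `A = ∫ P` and `F'' = exp (½ ∫ P)`
    (hA : ∀ x ∈ I, HasDerivAt A (P x) x)
    (hF : ∀ x ∈ I, deriv (deriv F) x = Real.exp (A x / 2))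
    -- the Ricci-flat scale: a nowhere vanishing solution of `η'' - Q η / 40 = 0`
    (hη : ContDiffOn ℝ 2 η I) (hη0 : ∀ x ∈ I, η x ≠ 0)
    (hη2 : ∀ x ∈ I, deriv (deriv η) x - 1 / 40 * GenChazy.chazyQ P x * η x = 0)
    -- `χ = ∫ η⁻²`
    (hχ : ∀ x ∈ I, HasDerivAt χ (1 / η x ^ 2) x) :
    -- the distribution annihilated by the three forms is spanned by `X¹` and `X²`
    (∀ m ∈ GenChazy.domain I,
      Submodule.span ℝ {GenChazy.X1 m, GenChazy.X2 A m} = GenChazy.chazyDistribution F m) ∧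
    -- `(c₁, …, c₅)` is a change of coordinates onto an open subset of `ℝ⁵`
    -- that maps the distribution to the flat Cartan distribution
    ContDiffOn ℝ ∞ (GenChazy.flattening P A η χ) (GenChazy.domain I) ∧
    Set.InjOn (GenChazy.flattening P A η χ) (GenChazy.domain I) ∧
    (∀ m ∈ GenChazy.domain I,
      (fderiv ℝ (GenChazy.flattening P A η χ) m).IsInvertible ∧
      (GenChazy.chazyDistribution F m).map
          (fderiv ℝ (GenChazy.flattening P A η χ) m).toLinearMap =
        GenChazy.flatCartan (GenChazy.flattening P A η χ m)) ∧
    -- `S¹` and `S²` lie in the distribution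
    (∀ m ∈ GenChazy.domain I,
      GenChazy.S1 P A η m ∈ GenChazy.chazyDistribution F m ∧
      GenChazy.S2 A η m ∈ GenChazy.chazyDistribution F m) ∧
    -- the change of coordinates maps `S¹, S², S³` to the flat fields
    (∀ m ∈ GenChazy.domain I,
      fderiv ℝ (GenChazy.flattening P A η χ) m (GenChazy.S1 P A η m) =
        GenChazy.flatS1 (GenChazy.flattening P A η χ m) ∧
      fderiv ℝ (GenChazy.flattening P A η χ) m (GenChazy.S2 A η m) =
        GenChazy.flatS2 (GenChazy.flattening P A η χ m) ∧
      fderiv ℝ (GenChazy.flattening P A η χ) m (GenChazy.S3 P A η χ m) =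
        GenChazy.flatS3 (GenChazy.flattening P A η χ m)) ∧
    -- `S¹, S², S³` are smooth vector fields on the domain
    -- and pairwise bracket-generate the Lie algebra of split `𝔤₂`
    ∃ s₁ s₂ s₃ : GenChazy.smoothVectorFields (GenChazy.domain I),
      Set.EqOn s₁.1 (GenChazy.S1 P A η) (GenChazy.domain I) ∧
      Set.EqOn s₂.1 (GenChazy.S2 A η) (GenChazy.domain I) ∧
      Set.EqOn s₃.1 (GenChazy.S3 P A η χ) (GenChazy.domain I) ∧
      GenChazy.PairwiseBracketGeneratesSplitG2 s₁ s₂ s₃ := by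
  have hsys := GenChazy.isChazySystem I.isOpen hP hA hη hη0 hη2 hχ
  have hsm := GenChazy.contDiffOn_flattening I hsys
  have hinv (m) (hm : m ∈ GenChazy.domain I) :
      (fderiv ℝ (GenChazy.flattening P A η χ) m).IsInvertible :=
    GenChazy.fderiv_flattening_isInvertible hsys hm
  have hspan (m) (hm : m ∈ GenChazy.domain I) :
      Submodule.span ℝ {GenChazy.X1 m, GenChazy.X2 A m} = GenChazy.chazyDistribution F m :=
    GenChazy.span_X1_X2 (hF _ hm)
  have hspan' (m) (hm : m ∈ GenChazy.domain I) :
      Submodule.span ℝ {GenChazy.S1 P A η m, GenChazy.S2 A η m} =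
        GenChazy.chazyDistribution F m :=
    (GenChazy.span_S1_S2 (hη0 _ hm)).trans (hspan m hm)
  have h₁ (m) (hm : m ∈ GenChazy.domain I) := GenChazy.fderiv_flattening_S1 hsys hm
  have h₂ (m) (hm : m ∈ GenChazy.domain I) := GenChazy.fderiv_flattening_S2 hsys hm
  have h₃ (m) (hm : m ∈ GenChazy.domain I) := GenChazy.fderiv_flattening_S3 hsys hm
  have hne' : (GenChazy.domain I : Set (Fin 5 → ℝ)).Nonempty := by
    obtain ⟨x, hx⟩ := hne
    exact ⟨fun _ => x, hx⟩
  refine ⟨hspan, hsm, GenChazy.injOn_flattening I hI hsys, fun m hm => ⟨hinv m hm, ?_⟩,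
    fun m hm => ?_, fun m hm => ⟨h₁ m hm, h₂ m hm, h₃ m hm⟩,
    GenChazy.exists_pairwiseBracketGeneratesSplitG2 hne' hsm hinv h₁ h₂ h₃⟩
  -- `S¹`, `S²` frame the distribution and their images frame the flat one, so the image of the span
  -- is the flat distribution.
  · rw [← hspan' m hm, Submodule.map_span, Set.image_pair, ← GenChazy.span_flatS1_flatS2]
    exact congrArg₂ (fun a b => Submodule.span ℝ {a, b}) (h₁ m hm) (h₂ m hm)
  · rw [← hspan' m hm]
    exact ⟨Submodule.subset_span (by simp), Submodule.subset_span (by simp)⟩
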